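/- **Setting.** Let $\mathcal B\subset\mathbb R_{\ge 0}$ be a finite set of bids with $0\in\mathcal B$, let $\rho>0$ and let $T\ge 1$. In round $t=1,\dots,T$ nature draws $\gamma_t=(v_t,x_t,p_t)$ i.i.d. from an unknown distribution $\mathcal P$, where $v_t\in[0,1]$ and $x_t,p_t:\mathcal B\to[0,1]$ are non-decreasing, $p_t(b)=0$ whenever $x_t(b)=0$, and $p_t(b)\le b$. Write $q_t(b)=x_t(b)p_t(b)$, $\overline v=\mathbb E[v_t]$, $\overline x(b)=\mathbb E[x_t(b)]$, $\overline q(b)=\mathbb E[q_t(b)]$, and assume that $\mathbb E[v_t x_t(b)]=\overline v\,\overline x(b)$ for every $b\in\mathcal B$ (for instance, $v_t$ is independent of $(x_t,p_t)$). The learner submits $b_t\in\mathcal B$, observes $x_t(\cdot)$ and $p_t(\cdot)$, wins with conditional probability $x_t(b_t)$ given the past, $\gamma_t$ and $b_t$, and observes $v_t$ only if it wins. Let $V$ be the value of the linear program: maximize $\sum_b w(b)\overline v\,\overline x(b)$ over probability distributions $w$ on $\mathcal B$ subject to $\sum_b w(b)\overline q(b)\le\sum_b w(b)\overline v\,\overline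 x(b)$ and $\sum_b w(b)\overline q(b)\le\rho$. **Algorithm UCB-RoS.** The first bid is $b_1=\max\mathcal B$. After $t\ge 1$ rounds let $\hat x_t,\hat q_t$ be the averages of $x_1,\dots,x_t$ and $q_1,\dots,q_t$, let $N_t$ be the number of rounds won so far, and let $\hat v_t$ be the average of the $N_t$ observed values. Let $\mathcal C^{x}_t$ (resp. $\mathcal C^{q}_t$) be the set of non-decreasing $f:\mathcal B\to[0,1]$ with $|f(b)-\hat x_t(b)|$ (resp. $|f(b)-\hat q_t(b)|$) at most $\sqrt{\log(2|\mathcal B|T)/(2t)}$ for all $b$, and $\mathcal C^{v}_t=\{v\in[0,1]:|v-\hat v_t|\le\sqrt{\log(2T)/(2N_t)}\}$, which is $[0,1]$ if $N_t=0$. In round $t+1$ the algorithm takes any optimizer $(w,x,q,v)$ (ties broken depending on the past only) of: maximize $\sum_b w(b)\,v\,x(b)$ over probability distributions $w$ on $\mathcal B$, $x\in\mathcal C^x_t$, $q\in\mathcal C^q_t$, $v\in\mathcal C^v_t$, subject to $\sum_b w(b)q(b)\le\sum_b w(b)\,v\,x(b)$ and $\sum_b w(b)q(b)\le\rho$; it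 then samples $b_{t+1}\sim w$ given the past, independently of $\gamma_{t+1}$. **Theorem.** There is a universal constant $C>0$ such that, in every such setting, the following hold, where expectations are over the auctions and the randomness of the algorithm. If $V>0$, then $$T\,V-\mathbb E\Big[\sum_{t=1}^T v_t x_t(b_t)\Big]\le C\max\left\{\sqrt{\frac{\overline v\,T\log(|\mathcal B|T)}{V}},\ \frac{\overline v^{2}\log(|\mathcal B|T)}{V^{2}}\right\}$$ and $$\mathbb E\Big[\sum_{t=1}^T\big(q_t(b_t)-v_t x_t(b_t)\big)\Big]\le C\sqrt{\frac{\overline v\,T\log(|\mathcal B|T)}{V}}.$$ Moreover (also if $V=0$), $$\mathbb E\Big[\sum_{t=1}^T q_t(b_t)-\rho T\Big]\le C\sqrt{T\log(|\mathcal B|T)}.$$ -/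

import Mathlib

open MeasureTheory ProbabilityTheory
open scoped NNReal

noncomputable section

namespace OnlineBidding

/-! ### Auctions -/

/-- One round of nature, `γ = (v, x, p)`: the value `v`, the allocation function `x` and the payment
function `p`, the latter two as functions on the finite bid set `ℬ`. -/
abbrev Auction (ℬ : Finset ℝ≥0) : Type := ℝ × (ℬ → ℝ) × (ℬ → ℝ)

namespace Auction

variable {ℬ : Finset ℝ≥0}

/-- The value `v` of the query. -/
def value (γ : Auction ℬ) : ℝ := γ.1

/-- The allocation function: `x b` is the probability of winning with bid `b`. -/
def alloc (γ : Auction ℬ) : ℬ → ℝ := γ.2.1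

/-- The payment function: `p b` is the payment required when the auction is won with bid `b`. -/
def price (γ : Auction ℬ) : ℬ → ℝ := γ.2.2

/-- The price paid for the bid `b`, namely `x b * p b`. -/
def paid (γ : Auction ℬ) (b : ℬ) : ℝ := γ.alloc b * γ.price b

/-- Values, allocations and payments lie in `[0, 1]`, allocation and payment are monotone in the bid,
the payment vanishes when the allocation does, and it never exceeds the bid. -/
structure IsAdmissible (γ : Auction ℬ) : Prop where
  value_mem : γ.value ∈ Set.Icc (0 : ℝ) 1
  alloc_mem : ∀ b, γ.alloc b ∈ Set.Icc (0 : ℝ) 1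
  price_mem : ∀ b, γ.price b ∈ Set.Icc (0 : ℝ) 1
  alloc_mono : Monotone γ.alloc
  price_mono : Monotone γ.price
  price_eq_zero : ∀ b, γ.alloc b = 0 → γ.price b = 0
  price_le_bid : ∀ b, γ.price b ≤ ((b : ℝ≥0) : ℝ)

end Auction

variable {ℬ : Finset ℝ≥0}

/-- The mean value `E[v]`. -/
def meanValue (P : Measure (Auction ℬ)) : ℝ := ∫ γ, γ.value ∂P

/-- The mean allocation `E[x b]`. -/
def meanAlloc (P : Measure (Auction ℬ)) (b : ℬ) : ℝ := ∫ γ, γ.alloc b ∂P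

/-- The mean price paid `E[x b * p b]`. -/
def meanPaid (P : Measure (Auction ℬ)) (b : ℬ) : ℝ := ∫ γ, γ.paid b ∂P

/-! ### The per-round problem and the benchmark -/

/-- Value obtained per round by bidding according to `w`. -/
def gain (w : ℬ → ℝ) (v : ℝ) (x : ℬ → ℝ) : ℝ := ∑ b, w b * v * x b

/-- Price paid per round when bidding according to `w`. -/
def spend (w : ℬ → ℝ) (q : ℬ → ℝ) : ℝ := ∑ b, w b * q b

/-- `w` is a probability distribution on bids that satisfies the per-round RoS constraint (with
target ratio 1) and the per-round budget constraint, for value `v`, allocation `x` and price `q`. -/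
structure IsFeasible (ρ : ℝ) (w : ℬ → ℝ) (v : ℝ) (x q : ℬ → ℝ) : Prop where
  mem_simplex : w ∈ stdSimplex ℝ ℬ
  ros : spend w q ≤ gain w v x
  budget : spend w q ≤ ρ

/-- The value `V` of the benchmark linear program. -/
def lpValue (ρ : ℝ) (P : Measure (Auction ℬ)) : ℝ :=
  sSup {r | ∃ w : ℬ → ℝ, IsFeasible ρ w (meanValue P) (meanAlloc P) (meanPaid P) ∧
    r = gain w (meanValue P) (meanAlloc P)}

/-! ### Estimators and confidence sets

Rounds are numbered `0, 1, 2, …`, so that after `n` completed rounds the data of the rounds `s < n`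
are available. -/

/-- Estimator of the allocation function after `n` rounds. -/
def allocEst (γ : ℕ → Auction ℬ) (n : ℕ) (b : ℬ) : ℝ := (∑ s ∈ Finset.range n, (γ s).alloc b) / n

/-- Estimator of the price paid after `n` rounds. -/
def paidEst (γ : ℕ → Auction ℬ) (n : ℕ) (b : ℬ) : ℝ := (∑ s ∈ Finset.range n, (γ s).paid b) / n

/-- Number of wins in the first `n` rounds. -/
def winCount (win : ℕ → Bool) (n : ℕ) : ℕ := ((Finset.range n).filter fun s => win s = true).card

/-- Average of the values observed in the first `n` rounds, i.e. over the rounds that were won. -/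
def valueEst (γ : ℕ → Auction ℬ) (win : ℕ → Bool) (n : ℕ) : ℝ :=
  (∑ s ∈ (Finset.range n).filter fun s => win s = true, (γ s).value) / winCount win n

/-- Confidence set of monotone functions `ℬ → [0, 1]` around the estimate `fHat` after `n` rounds,
for horizon `T`. -/
def functionConf (T n : ℕ) (fHat : ℬ → ℝ) : Set (ℬ → ℝ) :=
  {f | Monotone f ∧ (∀ b, f b ∈ Set.Icc (0 : ℝ) 1) ∧
    ∀ b, |f b - fHat b| ≤ √(Real.log (2 * (ℬ.card : ℝ) * T) / (2 * n))}

/-- Confidence set for the mean value after `N` wins with estimate `vHat`, for horizon `T`; before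
the first win it is all of `[0, 1]`. -/
def valueConf (T N : ℕ) (vHat : ℝ) : Set ℝ :=
  {v | v ∈ Set.Icc (0 : ℝ) 1 ∧ (0 < N → |v - vHat| ≤ √(Real.log (2 * T) / (2 * N)))}

/-- `(w, v, x, q)` is feasible for the optimistic problem posed by the data of the first `n`
rounds. -/
structure IsOptimisticFeasible (ρ : ℝ) (T n : ℕ) (γ : ℕ → Auction ℬ) (win : ℕ → Bool)
    (w : ℬ → ℝ) (v : ℝ) (x q : ℬ → ℝ) : Prop extends IsFeasible ρ w v x q where
  alloc_mem : x ∈ functionConf T n (allocEst γ n)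
  paid_mem : q ∈ functionConf T n (paidEst γ n)
  value_mem : v ∈ valueConf T (winCount win n) (valueEst γ win n)

/-- `w` is the bid distribution of some optimizer `(w, v, x, q)` of the optimistic problem posed by
the data of the first `n` rounds. -/
def IsOptimisticChoice (ρ : ℝ) (T n : ℕ) (γ : ℕ → Auction ℬ) (win : ℕ → Bool) (w : ℬ → ℝ) : Prop :=
  ∃ (v : ℝ) (x q : ℬ → ℝ), IsOptimisticFeasible ρ T n γ win w v x q ∧
    ∀ (w' : ℬ → ℝ) (v' : ℝ) (x' q' : ℬ → ℝ),
      IsOptimisticFeasible ρ T n γ win w' v' x' q' → gain w' v' x' ≤ gain w v x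

/-! ### Runs of the algorithm -/

/-- A run of UCB-RoS with bid set `ℬ`, per-round budget `ρ` and horizon `T` on auctions drawn i.i.d.
from `P`, on the probability space `(Ω, μ)`. Here `ℱ t` is the information available before round
`t`, and `bidDist t` is the distribution chosen by the algorithm for round `t`. Ties between
optimizers may be broken in any way that depends on the past only. -/
structure UCBRoSRun {Ω : Type*} [mΩ : MeasurableSpace Ω] (μ : Measure Ω) (ℬ : Finset ℝ≥0) (ρ : ℝ)
    (T : ℕ) (P : Measure (Auction ℬ)) where
  /-- The information before each round. -/
  ℱ : Filtration ℕ mΩ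
  /-- The auction of each round. -/
  auction : ℕ → Ω → Auction ℬ
  /-- The distribution from which the bid is drawn, in every round but the first. -/
  bidDist : ℕ → Ω → ℬ → ℝ
  /-- The submitted bids. -/
  bid : ℕ → Ω → ℬ
  /-- Whether the round is won. -/
  win : ℕ → Ω → Bool
  measurable_auction : ∀ t < T, Measurable[ℱ (t + 1)] (auction t)
  measurable_bid : ∀ t < T, Measurable[ℱ (t + 1)] (bid t)
  measurable_win : ∀ t < T, Measurable[ℱ (t + 1)] (win t)
  measurable_bidDist : ∀ t < T, 0 < t → Measurable[ℱ t] (bidDist t)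
  /-- Each auction has law `P` … -/
  auction_law : ∀ t < T, μ.map (auction t) = P
  /-- … and is independent of the past. -/
  auction_indep : ∀ t < T, Indep (MeasurableSpace.comap (auction t) inferInstance) (ℱ t) μ
  /-- The first bid is the largest one. -/
  bid_first : 0 < T → ∀ᵐ ω ∂μ, ∀ b : ℬ, b ≤ bid 0 ω
  /-- In every later round the bid distribution solves the optimistic problem … -/
  bidDist_optimal : ∀ t < T, 0 < t → ∀ᵐ ω ∂μ,
    IsOptimisticChoice ρ T t (fun s => auction s ω) (fun s => win s ω) (bidDist t ω)
  /-- … and the bid is sampled from it, independently of the auction of the round. -/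
  bid_law : ∀ t < T, 0 < t → ∀ b : ℬ,
    μ[Set.indicator {ω | bid t ω = b} (fun _ => (1 : ℝ)) |
      ℱ t ⊔ MeasurableSpace.comap (auction t) inferInstance] =ᵐ[μ] fun ω => bidDist t ω b
  /-- Given the past, the auction and the bid, the round is won with the probability prescribed by
  the allocation function. -/
  win_law : ∀ t < T,
    μ[Set.indicator {ω | win t ω = true} (fun _ => (1 : ℝ)) |
      ℱ t ⊔ MeasurableSpace.comap (auction t) inferInstance
        ⊔ MeasurableSpace.comap (bid t) inferInstance]
      =ᵐ[μ] fun ω => (auction t ω).alloc (bid t ω)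

namespace UCBRoSRun

variable {Ω : Type*} [MeasurableSpace Ω] {μ : Measure Ω} {ρ : ℝ} {T : ℕ} {P : Measure (Auction ℬ)}

/-- The total value collected, `∑ v_t x_t(b_t)`. -/
def reward (R : UCBRoSRun μ ℬ ρ T P) (ω : Ω) : ℝ :=
  ∑ t ∈ Finset.range T, (R.auction t ω).value * (R.auction t ω).alloc (R.bid t ω)

/-- The total price paid, `∑ x_t(b_t) p_t(b_t)`. -/
def totalPaid (R : UCBRoSRun μ ℬ ρ T P) (ω : Ω) : ℝ :=
  ∑ t ∈ Finset.range T, (R.auction t ω).paid (R.bid t ω)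

/-- The expected regret `T V - E[reward]`. -/
def regret (R : UCBRoSRun μ ℬ ρ T P) : ℝ := T * lpValue ρ P - ∫ ω, R.reward ω ∂μ

/-- The expected violation of the RoS constraint. -/
def rosViolation (R : UCBRoSRun μ ℬ ρ T P) : ℝ := ∫ ω, (R.totalPaid ω - R.reward ω) ∂μ

/-- The expected violation of the budget constraint. -/
def budgetViolation (R : UCBRoSRun μ ℬ ρ T P) : ℝ := ∫ ω, (R.totalPaid ω - ρ * T) ∂μ

end UCBRoSRun

end OnlineBidding

end

/-!
All three bounds follow from a single estimate: the regret and both constraint violations are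
`O(√(T log (|ℬ| T)))`. The benchmark satisfies `V ≤ E[v]`, so the factor `E[v] / V` under the root
in the bounds for the regret and the RoS constraint is at least `1`.

Suppose that after `t ≥ 1` rounds the confidence sets contain the means of allocation, price and
value. Then the optimal value of the optimistic problem is at least `V`, and replacing the
optimistic parameters by the true ones changes gain and spend of the chosen distribution `w` by at
most the widths of the confidence sets, where the width for the value enters with the factor
`∑ b, w b * E[x b]` (`IsOptimisticChoice.bounds`). This factor is the conditional probability of
winning the round. The width after `n` wins is therefore charged in expectation only when the
`(n + 1)`-st win occurs, and the charges sum to `1 + ∑ 1 ≤ n < T, O(√(log T / n)) = O(√(T log T))`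
(`sum_valueWidth_mul_winInd`, `integral_sum_le`). The widths for allocation and price sum to
`O(√(T log (|ℬ| T)))`.

It remains to bound the probability that a confidence set misses the truth, each such round costing
at most `1`. For allocation and price this is Hoeffding's inequality and a union bound over bids.
For the value, the sample size is the random number of wins `N`. Since value and allocation are
uncorrelated, `exp (l * M - l ^ 2 * N / 8)` is a supermartingale for every `l`, where `M` is the
deviation of the sum of the observed values (`integral_exp_valueDev_le`). A union over the `√T`
possible integer parts of `√N`, each with its own `l`, gives a failure probability `O(1 / √T)`
(`exp_sub_le_twoSidedExp_of_lt`, `integral_failBound_le`), hence a total cost of `O(√T)`.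
-/

namespace OnlineBidding

/-! ### Hoeffding's lemma and deviations -/

/-- Hoeffding's lemma for a Bernoulli variable with mean `p`. -/
lemma bernoulli_mgf_le {p : ℝ} (hp : p ∈ Set.Icc (0 : ℝ) 1) (l : ℝ) :
    (1 - p) * Real.exp (l * (0 - p)) + p * Real.exp (l * (1 - p)) ≤ Real.exp (l ^ 2 / 8) := by
  set ν : Measure ℝ := ENNReal.ofReal (1 - p) • Measure.dirac 0 + ENNReal.ofReal p • Measure.dirac 1
    with hν
  have h1p : 0 ≤ 1 - p := by linarith [hp.2]
  have hprob : IsProbabilityMeasure ν := by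
    constructor
    simp only [hν, Measure.coe_add, Measure.coe_smul, Pi.add_apply, Pi.smul_apply, measure_univ,
      smul_eq_mul, mul_one]
    rw [← ENNReal.ofReal_add h1p hp.1]
    simp
  have hint : ∀ f : ℝ → ℝ, ∫ x, f x ∂ν = (1 - p) * f 0 + p * f 1 := by
    intro f
    rw [hν, integral_add_measure, integral_smul_measure, integral_smul_measure, integral_dirac,
      integral_dirac, ENNReal.toReal_ofReal h1p, ENNReal.toReal_ofReal hp.1, smul_eq_mul,
      smul_eq_mul]
    · exact (integrable_dirac (by finiteness)).smul_measure ENNReal.ofReal_ne_top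
    · exact (integrable_dirac (by finiteness)).smul_measure ENNReal.ofReal_ne_top
  have hmem : ∀ᵐ x ∂ν, x ∈ Set.Icc (0 : ℝ) 1 := by
    rw [hν, ae_add_measure_iff]
    constructor <;> refine Measure.ae_smul_measure ?_ _ <;> rw [ae_dirac_eq] <;> simp
  have h := (hasSubgaussianMGF_of_mem_Icc (X := id) aemeasurable_id hmem).mgf_le l
  rw [mgf, hint, hint] at h
  simp only [id, mul_zero, mul_one, zero_add, sub_zero, nnnorm_one] at h
  refine (le_of_eq ?_).trans (h.trans (le_of_eq ?_))
  · simp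
  · congr 1
    push_cast
    ring

/-- Hoeffding's lemma with respect to a weight `g` under which `f` has mean `m`. -/
lemma integral_weight_mul_exp_le {S : Type*} [MeasurableSpace S] {P : Measure S}
    [IsProbabilityMeasure P] {f g : S → ℝ} (hf : Measurable f) (hg : Measurable g)
    (hf01 : ∀ᵐ s ∂P, f s ∈ Set.Icc (0 : ℝ) 1) (hg01 : ∀ᵐ s ∂P, g s ∈ Set.Icc (0 : ℝ) 1)
    {m : ℝ} (hm : m ∈ Set.Icc (0 : ℝ) 1) (hfg : ∫ s, f s * g s ∂P = m * ∫ s, g s ∂P) (l : ℝ) :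
    ∫ s, g s * (Real.exp (l * (f s - m) - l ^ 2 / 8) - 1) ∂P ≤ 0 := by
  have hgi : Integrable g P := Integrable.of_bound hg.aestronglyMeasurable 1 (by
    filter_upwards [hg01] with s hs
    rw [Real.norm_eq_abs, abs_le]; constructor <;> linarith [hs.1, hs.2])
  have hfgi : Integrable (fun s => f s * g s) P :=
    Integrable.of_bound (hf.mul hg).aestronglyMeasurable 1 (by
      filter_upwards [hg01, hf01] with s hs hs'
      rw [Real.norm_eq_abs, abs_le]
      constructor <;> nlinarith [hs.1, hs.2, hs'.1, hs'.2])
  set a := Real.exp (l * (0 - m) - l ^ 2 / 8)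
  set b := Real.exp (l * (1 - m) - l ^ 2 / 8)
  have hab : (1 - m) * a + m * b ≤ 1 := by
    have h := bernoulli_mgf_le hm l
    have ha : a = Real.exp (l * (0 - m)) * Real.exp (-(l ^ 2 / 8)) := by
      rw [← Real.exp_add, ← sub_eq_add_neg]
    have hb : b = Real.exp (l * (1 - m)) * Real.exp (-(l ^ 2 / 8)) := by
      rw [← Real.exp_add, ← sub_eq_add_neg]
    have h1 : Real.exp (l ^ 2 / 8) * Real.exp (-(l ^ 2 / 8)) = 1 := by
      rw [← Real.exp_add, add_neg_cancel, Real.exp_zero]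
    rw [ha, hb]
    nlinarith [mul_le_mul_of_nonneg_right h (Real.exp_nonneg (-(l ^ 2 / 8)))]
  -- By convexity the exponential lies below the chord through the endpoints of `[0, 1]`.
  have hle : ∀ᵐ s ∂P, g s * (Real.exp (l * (f s - m) - l ^ 2 / 8) - 1)
      ≤ (a - 1) * g s + (b - a) * (f s * g s) := by
    filter_upwards [hg01, hf01] with s hs hs'
    have hc := convexOn_exp.2 (Set.mem_univ (l * (0 - m) - l ^ 2 / 8))
      (Set.mem_univ (l * (1 - m) - l ^ 2 / 8))
      (sub_nonneg.2 hs'.2) hs'.1 (sub_add_cancel 1 (f s))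
    simp only [smul_eq_mul] at hc
    rw [show (1 - f s) * (l * (0 - m) - l ^ 2 / 8) + f s * (l * (1 - m) - l ^ 2 / 8)
      = l * (f s - m) - l ^ 2 / 8 by ring] at hc
    nlinarith [mul_le_mul_of_nonneg_left hc hs.1]
  have hli : Integrable (fun s => g s * (Real.exp (l * (f s - m) - l ^ 2 / 8) - 1)) P := by
    refine Integrable.of_bound (by fun_prop) (Real.exp |l| + 1) ?_
    filter_upwards [hg01, hf01] with s hs hs'
    rw [Real.norm_eq_abs, abs_mul, abs_of_nonneg hs.1]
    have h1 : Real.exp (l * (f s - m) - l ^ 2 / 8) ≤ Real.exp |l| := by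
      apply Real.exp_le_exp.2
      have : l * (f s - m) ≤ |l| * 1 := by
        refine (le_abs_self _).trans ?_
        rw [abs_mul]
        refine mul_le_mul_of_nonneg_left ?_ (abs_nonneg _)
        rw [abs_le]; constructor <;> linarith [hs'.1, hs'.2, hm.1, hm.2]
      nlinarith [sq_nonneg l]
    have h2 := Real.exp_pos (l * (f s - m) - l ^ 2 / 8)
    have h3 : |Real.exp (l * (f s - m) - l ^ 2 / 8) - 1| ≤ Real.exp |l| + 1 := by
      rw [abs_le]; constructor <;> linarith
    calc g s * _ ≤ 1 * (Real.exp |l| + 1) := mul_le_mul hs.2 h3 (abs_nonneg _) (by norm_num)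
      _ = _ := one_mul _
  calc _ ≤ ∫ s, ((a - 1) * g s + (b - a) * (f s * g s)) ∂P :=
        integral_mono_ae hli ((hgi.const_mul _).add (hfgi.const_mul _)) hle
    _ = ((1 - m) * a + m * b - 1) * ∫ s, g s ∂P := by
        rw [integral_add (hgi.const_mul _) (hfgi.const_mul _), integral_const_mul,
          integral_const_mul, hfg]
        ring
    _ ≤ 0 := mul_nonpos_of_nonpos_of_nonneg (by linarith)
        (integral_nonneg_of_ae (hg01.mono fun s hs => hs.1))

/-- The sum of the two one-sided exponentials of a deviation `S` with variance proxy `n / 4`. -/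
noncomputable def twoSidedExp (l S n : ℝ) : ℝ :=
  Real.exp (l * S - l ^ 2 * n / 8) + Real.exp (-l * S - (-l) ^ 2 * n / 8)

lemma twoSidedExp_nonneg (l S n : ℝ) : 0 ≤ twoSidedExp l S n := by
  unfold twoSidedExp; positivity

lemma exp_le_twoSidedExp (l S n : ℝ) : Real.exp (l * |S| - l ^ 2 * n / 8) ≤ twoSidedExp l S n := by
  unfold twoSidedExp
  rcases abs_cases S with ⟨h, -⟩ | ⟨h, -⟩ <;> rw [h]
  · linarith [Real.exp_pos (-l * S - (-l) ^ 2 * n / 8)]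
  · rw [show l * -S - l ^ 2 * n / 8 = -l * S - (-l) ^ 2 * n / 8 by ring]
    linarith [Real.exp_pos (l * S - l ^ 2 * n / 8)]

/-- A deviation of an average of `n` terms beyond the confidence radius is detected by the parameter
that is optimal for sample size `n`. -/
lemma exp_le_twoSidedExp_of_lt {n L S : ℝ} (hn : 0 < n) (hL : 0 ≤ L)
    (h : √(L / (2 * n)) < |S| / n) : Real.exp L ≤ twoSidedExp (4 * √(L / (2 * n))) S n := by
  refine le_trans (Real.exp_le_exp.2 ?_) (exp_le_twoSidedExp _ _ _)
  set r := √(L / (2 * n))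
  have hr : r ^ 2 * (2 * n) = L := by
    rw [Real.sq_sqrt (by positivity)]; field_simp
  have hr0 : 0 ≤ r := Real.sqrt_nonneg _
  rw [lt_div_iff₀ hn] at h
  nlinarith [mul_le_mul_of_nonneg_left h.le hr0]

/-- A deviation of an average of `n` terms beyond the confidence radius is detected by one of the
roughly `√n` parameters `4 √(L / 2) / j`, where `j` only has to match `√n` up to rounding. -/
lemma exp_sub_le_twoSidedExp_of_lt {n : ℕ} {L S : ℝ} (hn : 0 < n) (hL : 0 ≤ L) (hS : |S| ≤ n)
    (h : √(L / (2 * n)) < |S| / n) :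
    Real.exp (L - 8) ≤ twoSidedExp (4 * √(L / 2) / Nat.sqrt n) S n := by
  refine le_trans (Real.exp_le_exp.2 ?_) (exp_le_twoSidedExp _ _ _)
  have hn' : (0 : ℝ) < n := by exact_mod_cast hn
  set j : ℝ := (Nat.sqrt n : ℝ) with hj
  have hj1 : 1 ≤ j := by
    rw [hj]; exact_mod_cast Nat.sqrt_pos.2 hn
  have hj2 : j ^ 2 ≤ n := by
    rw [hj]; exact_mod_cast Nat.sqrt_le' n
  have hj3 : (n : ℝ) ≤ (j + 1) ^ 2 := by
    rw [hj]; exact_mod_cast (Nat.lt_succ_sqrt' n).le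
  set s := √(n : ℝ)
  have hs : s ^ 2 = n := Real.sq_sqrt hn'.le
  have hs0 : 0 < s := Real.sqrt_pos.2 hn'
  set r := √(L / 2)
  have hr : r ^ 2 = L / 2 := Real.sq_sqrt (by positivity)
  have hr0 : 0 ≤ r := Real.sqrt_nonneg _
  have hrs : √(L / (2 * n)) = r / s := by
    rw [← div_div, Real.sqrt_div (by positivity)]
  rw [hrs, lt_div_iff₀ hn', ← hs] at h
  have h1 : r * s < |S| := by
    calc r * s = r / s * s ^ 2 := by field_simp
      _ < _ := h
  have hrs' : r < s := by
    rw [← hs] at hS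
    nlinarith
  have hjs : j ≤ s := by
    refine (sq_le_sq₀ (by linarith) hs0.le).1 ?_
    rw [hs]; exact hj2
  have hsj : s ≤ j + 1 := by
    refine (sq_le_sq₀ hs0.le (by linarith)).1 ?_
    rw [hs]; exact hj3
  have hj0 : 0 < j := by linarith
  have hLr : L = 2 * r ^ 2 := by linarith
  have h2 : 4 * r / j * (r * s) ≤ 4 * r / j * |S| := by gcongr
  -- The optimal parameter has `√n` in place of `j` and gives the exponent `L`. Rounding costs
  -- `L (√n / j - 1) ^ 2 ≤ L / j ^ 2`, and this is at most `8` because `|S| ≤ n` forces `L < 2 n`.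
  have h3 : L - 8 ≤ 4 * r / j * (r * s) - (4 * r / j) ^ 2 * n / 8 := by
    have e : 4 * r / j * (r * s) - (4 * r / j) ^ 2 * n / 8 - (L - 8)
        = (8 * j ^ 2 - 2 * (r * (s - j)) ^ 2) / j ^ 2 := by
      rw [← hs, hLr]; field_simp; ring
    have h4 : r * (s - j) ≤ 2 * j := by
      have : r ≤ 2 * j := by linarith
      nlinarith
    have h5 : 0 ≤ r * (s - j) := mul_nonneg hr0 (by linarith)
    have : 0 ≤ (8 * j ^ 2 - 2 * (r * (s - j)) ^ 2) / j ^ 2 := by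
      apply div_nonneg _ (by positivity)
      nlinarith
    linarith
  linarith

lemma sum_inv_sqrt_le (n : ℕ) : ∑ k ∈ Finset.range n, 1 / √((k : ℝ) + 1) ≤ 2 * √(n : ℝ) := by
  induction n with
  | zero => simp
  | succ n ih =>
    rw [Finset.sum_range_succ]
    push_cast
    set a := √(n : ℝ)
    set b := √((n : ℝ) + 1)
    have ha : a ^ 2 = n := Real.sq_sqrt (by positivity)
    have hb : b ^ 2 = n + 1 := Real.sq_sqrt (by positivity)
    have ha0 : 0 ≤ a := Real.sqrt_nonneg _
    have hb0 : 0 < b := Real.sqrt_pos.2 (by positivity)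
    have : 1 / b ≤ 2 * b - 2 * a := by
      rw [div_le_iff₀ hb0]
      nlinarith [sq_nonneg (b - a)]
    linarith

/-! ### The optimistic problem -/

variable {ℬ : Finset ℝ≥0}

/-- Confidence radius of the allocation and of the price paid after `n` rounds. -/
noncomputable def functionRadius (ℬ : Finset ℝ≥0) (T n : ℕ) : ℝ :=
  √(Real.log (2 * (ℬ.card : ℝ) * T) / (2 * n))

/-- A bound on the width of the confidence set of the value after `n` wins, equal to `1` before the
first win. -/
noncomputable def valueWidth (T n : ℕ) : ℝ :=
  if n = 0 then 1 else 2 * √(Real.log (2 * T) / (2 * n))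

lemma valueWidth_nonneg (T n : ℕ) : 0 ≤ valueWidth T n := by
  unfold valueWidth; split_ifs <;> positivity

lemma functionRadius_nonneg (ℬ : Finset ℝ≥0) (T n : ℕ) : 0 ≤ functionRadius ℬ T n :=
  Real.sqrt_nonneg _

lemma abs_sub_le_of_mem_functionConf {T n : ℕ} {fHat f g : ℬ → ℝ}
    (hf : f ∈ functionConf T n fHat) (hg : g ∈ functionConf T n fHat) (b : ℬ) :
    |f b - g b| ≤ 2 * functionRadius ℬ T n := by
  have h1 := abs_le.1 (hf.2.2 b)
  have h2 := abs_le.1 (hg.2.2 b)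
  unfold functionRadius
  rw [abs_le]
  constructor <;> linarith [h1.1, h1.2, h2.1, h2.2]

lemma abs_sub_le_of_mem_valueConf {T N : ℕ} {vHat v v' : ℝ}
    (hv : v ∈ valueConf T N vHat) (hv' : v' ∈ valueConf T N vHat) :
    |v - v'| ≤ valueWidth T N := by
  unfold valueWidth
  split_ifs with h
  · rw [abs_le]; constructor <;> linarith [hv.1.1, hv.1.2, hv'.1.1, hv'.1.2]
  · have h1 := abs_le.1 (hv.2 (Nat.pos_of_ne_zero h))
    have h2 := abs_le.1 (hv'.2 (Nat.pos_of_ne_zero h))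
    rw [abs_le]
    constructor <;> linarith [h1.1, h1.2, h2.1, h2.2]

/-- A linear functional of a distribution `w` changes by at most the weighted change of its
coefficients. -/
lemma sum_mul_le_sum_mul_add {w f g e : ℬ → ℝ} (hw : w ∈ stdSimplex ℝ ℬ)
    (h : ∀ b, f b ≤ g b + e b) : ∑ b, w b * f b ≤ ∑ b, w b * g b + ∑ b, w b * e b := by
  rw [← Finset.sum_add_distrib]
  refine Finset.sum_le_sum fun b _ => ?_
  rw [← mul_add]
  exact mul_le_mul_of_nonneg_left (h b) (hw.1 b)

lemma gain_eq (w : ℬ → ℝ) (v : ℝ) (x : ℬ → ℝ) : gain w v x = ∑ b, w b * (v * x b) := by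
  simp [gain, mul_assoc]

/-- When the confidence sets contain the true parameters, bidding according to an optimistic choice
loses at most the widths of the confidence sets, the one for the value being weighted with the
probability of winning. -/
lemma IsOptimisticChoice.bounds {ρ : ℝ} {T n : ℕ} {γ : ℕ → Auction ℬ} {win : ℕ → Bool}
    {w x q : ℬ → ℝ} {v : ℝ} (h : IsOptimisticChoice ρ T n γ win w)
    (hx : x ∈ functionConf T n (allocEst γ n)) (hq : q ∈ functionConf T n (paidEst γ n))
    (hv : v ∈ valueConf T (winCount win n) (valueEst γ win n)) :
    (∀ w', IsFeasible ρ w' v x q → gain w' v x ≤ gain w v x + (4 * functionRadius ℬ T n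
      + valueWidth T (winCount win n) * ∑ b, w b * x b)) ∧
    spend w q ≤ gain w v x + (4 * functionRadius ℬ T n
      + valueWidth T (winCount win n) * ∑ b, w b * x b) ∧
    spend w q ≤ ρ + (4 * functionRadius ℬ T n
      + valueWidth T (winCount win n) * ∑ b, w b * x b) := by
  obtain ⟨v', x', q', hf, hopt⟩ := h
  have hw := hf.mem_simplex
  set ε := functionRadius ℬ T n
  set ψ := valueWidth T (winCount win n)
  have hε : 0 ≤ ε := functionRadius_nonneg _ _ _
  have hψ : 0 ≤ ψ := valueWidth_nonneg _ _
  have hxw : 0 ≤ ∑ b, w b * x b := Finset.sum_nonneg fun b _ => mul_nonneg (hw.1 b) (hx.2.1 b).1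
  have hψx : 0 ≤ ψ * ∑ b, w b * x b := mul_nonneg hψ hxw
  have hconst : ∑ b, w b * (2 * ε) = 2 * ε := by rw [← Finset.sum_mul, hw.2, one_mul]
  have hgain : gain w v' x' ≤ gain w v x + (2 * ε + ψ * ∑ b, w b * x b) := by
    have h1 : ∑ b, w b * (2 * ε + ψ * x b) = 2 * ε + ψ * ∑ b, w b * x b := by
      simp only [mul_add, Finset.sum_add_distrib]
      rw [hconst, Finset.mul_sum]
      simp only [mul_left_comm]
    rw [gain_eq, gain_eq, ← h1]
    refine sum_mul_le_sum_mul_add hw fun b => ?_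
    have h2 := (abs_le.1 (abs_sub_le_of_mem_functionConf hf.alloc_mem hx b)).2
    have h3 := (abs_le.1 (abs_sub_le_of_mem_valueConf hf.value_mem hv)).2
    have hv'0 := hf.value_mem.1
    have h4 : v' * (x' b - x b) ≤ 2 * ε :=
      (mul_le_mul_of_nonneg_left h2 hv'0.1).trans
        (mul_le_of_le_one_left (by positivity) hv'0.2)
    have h5 : (v' - v) * x b ≤ ψ * x b := mul_le_mul_of_nonneg_right h3 (hx.2.1 b).1
    nlinarith
  have hspend : spend w q ≤ spend w q' + 2 * ε := by
    rw [← hconst]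
    refine sum_mul_le_sum_mul_add hw fun b => ?_
    have := (abs_le.1 (abs_sub_le_of_mem_functionConf hq hf.paid_mem b)).2
    linarith
  refine ⟨fun w' hw' => ?_, ?_, ?_⟩
  · have := hopt w' v x q ⟨hw', hx, hq, hv⟩
    linarith
  · linarith [hf.ros]
  · linarith [hf.budget]

/-! ### Expectations along a run -/

section Measurability

variable {ℬ : Finset ℝ≥0}

@[fun_prop]
lemma Auction.measurable_value : Measurable (Auction.value : Auction ℬ → ℝ) := measurable_fst

@[fun_prop]
lemma Auction.measurable_alloc (b : ℬ) : Measurable fun γ : Auction ℬ => γ.alloc b :=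
  (measurable_pi_apply b).comp (measurable_fst.comp measurable_snd)

@[fun_prop]
lemma Auction.measurable_paid (b : ℬ) : Measurable fun γ : Auction ℬ => γ.paid b :=
  (Auction.measurable_alloc b).mul
    ((measurable_pi_apply b).comp (measurable_snd.comp measurable_snd))

lemma Auction.IsAdmissible.paid_mem {γ : Auction ℬ} (h : γ.IsAdmissible) (b : ℬ) :
    γ.paid b ∈ Set.Icc (0 : ℝ) 1 :=
  ⟨mul_nonneg (h.alloc_mem b).1 (h.price_mem b).1,
    mul_le_one₀ (h.alloc_mem b).2 (h.price_mem b).1 (h.price_mem b).2⟩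

lemma Auction.IsAdmissible.paid_mono {γ : Auction ℬ} (h : γ.IsAdmissible) : Monotone γ.paid :=
  fun _ _ hb => mul_le_mul (h.alloc_mono hb) (h.price_mono hb) (h.price_mem _).1 (h.alloc_mem _).1

end Measurability

lemma integrable_of_mem_Icc {S : Type*} [MeasurableSpace S] {P : Measure S}
    [IsFiniteMeasure P] {f : S → ℝ} (hf : Measurable f)
    (h : ∀ᵐ s ∂P, f s ∈ Set.Icc (0 : ℝ) 1) : Integrable f P :=
  Integrable.of_bound hf.aestronglyMeasurable 1 (by
    filter_upwards [h] with s hs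
    rw [Real.norm_eq_abs, abs_le]
    constructor <;> linarith [hs.1, hs.2])

lemma integral_mem_Icc {S : Type*} [MeasurableSpace S] {P : Measure S}
    [IsProbabilityMeasure P] {f : S → ℝ} (hf : Measurable f)
    (h : ∀ᵐ s ∂P, f s ∈ Set.Icc (0 : ℝ) 1) : ∫ s, f s ∂P ∈ Set.Icc (0 : ℝ) 1 := by
  refine ⟨integral_nonneg_of_ae (h.mono fun s hs => hs.1), ?_⟩
  calc ∫ s, f s ∂P ≤ ∫ _, (1 : ℝ) ∂P :=
        integral_mono_ae (integrable_of_mem_Icc hf h) (integrable_const _) (h.mono fun s hs => hs.2)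
    _ = 1 := by simp

/-- A bounded `m`-measurable factor sees only the conditional probability of an event. -/
lemma integral_mul_indicator_eq {Ω : Type*} {m mΩ : MeasurableSpace Ω} {μ : Measure Ω}
    [IsProbabilityMeasure μ] (hm : m ≤ mΩ) {A : Set Ω} (hA : MeasurableSet A) {g Y : Ω → ℝ}
    (h : μ[A.indicator (fun _ => (1 : ℝ)) | m] =ᵐ[μ] g) (hY : Measurable[m] Y) {K : ℝ}
    (hYK : ∀ᵐ ω ∂μ, |Y ω| ≤ K) :
    ∫ ω, Y ω * A.indicator (fun _ => (1 : ℝ)) ω ∂μ = ∫ ω, Y ω * g ω ∂μ := by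
  have hi : Integrable (A.indicator (fun _ => (1 : ℝ))) μ := (integrable_const _).indicator hA
  have h1 := condExp_stronglyMeasurable_mul_of_bound hm hY.stronglyMeasurable hi K hYK
  calc ∫ ω, Y ω * A.indicator (fun _ => (1 : ℝ)) ω ∂μ
      = ∫ ω, (μ[Y * A.indicator (fun _ => (1 : ℝ)) | m]) ω ∂μ := (integral_condExp hm).symm
    _ = ∫ ω, Y ω * g ω ∂μ := integral_congr_ae (by
        filter_upwards [h1, h] with ω h1 h2
        rw [h1, Pi.mul_apply, h2])

namespace UCBRoSRun

variable {ℬ : Finset ℝ≥0} {Ω : Type*} [mΩ : MeasurableSpace Ω] {μ : Measure Ω}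
  {ρ : ℝ} {T : ℕ} {P : Measure (Auction ℬ)} (R : UCBRoSRun μ ℬ ρ T P)

lemma auction_meas {t : ℕ} (ht : t < T) : Measurable (R.auction t) :=
  (R.measurable_auction t ht).mono (R.ℱ.le _) le_rfl

lemma bid_meas {t : ℕ} (ht : t < T) : Measurable (R.bid t) :=
  (R.measurable_bid t ht).mono (R.ℱ.le _) le_rfl

lemma ae_auction {p : Auction ℬ → Prop} (h : ∀ᵐ γ ∂P, p γ) {t : ℕ} (ht : t < T) :
    ∀ᵐ ω ∂μ, p (R.auction t ω) := by
  rw [← R.auction_law t ht] at h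
  exact ae_of_ae_map (R.auction_meas ht).aemeasurable h

lemma integral_auction {f : Auction ℬ → ℝ} (hf : Measurable f) {t : ℕ} (ht : t < T) :
    ∫ ω, f (R.auction t ω) ∂μ = ∫ γ, f γ ∂P := by
  conv_rhs => rw [← R.auction_law t ht]
  exact (integral_map (R.auction_meas ht).aemeasurable hf.aestronglyMeasurable).symm

/-- A quantity determined by the past is independent of the auction of the round. -/
lemma integral_mul_auction {Z : Ω → ℝ} {t : ℕ} (ht : t < T) (hZ : Measurable[R.ℱ t] Z)
    {f : Auction ℬ → ℝ} (hf : Measurable f) :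
    ∫ ω, Z ω * f (R.auction t ω) ∂μ = (∫ ω, Z ω ∂μ) * ∫ γ, f γ ∂P := by
  have hind : IndepFun Z (fun ω => f (R.auction t ω)) μ := by
    rw [IndepFun_iff_Indep]
    refine indep_of_indep_of_le_left (indep_of_indep_of_le_right (R.auction_indep t ht).symm ?_)
      hZ.comap_le
    rw [show (fun ω => f (R.auction t ω)) = f ∘ R.auction t from rfl, ← MeasurableSpace.comap_comp]
    exact MeasurableSpace.comap_mono hf.comap_le
  rw [hind.integral_fun_mul_eq_mul_integral
    (hZ.mono (R.ℱ.le _) le_rfl).aestronglyMeasurable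
    (hf.comp (R.auction_meas ht)).aestronglyMeasurable, R.integral_auction hf ht]

open Classical in
/-- The distribution of the bid of round `t` given the past: the point mass at the largest bid in
the first round, and `bidDist t` afterwards. -/
noncomputable def actionDist (t : ℕ) (ω : Ω) (b : ℬ) : ℝ :=
  if t = 0 then (if ∀ b' : ℬ, b' ≤ b then 1 else 0) else R.bidDist t ω b

lemma measurable_actionDist {t : ℕ} (ht : t < T) (b : ℬ) :
    Measurable[R.ℱ t] fun ω => R.actionDist t ω b := by
  by_cases h : t = 0
  · simp only [actionDist, h, if_true]
    exact measurable_const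
  · simp only [actionDist, h, if_false]
    exact (measurable_pi_apply b).comp (R.measurable_bidDist t ht (Nat.pos_of_ne_zero h))

lemma ae_actionDist_mem {t : ℕ} (ht : t < T) :
    ∀ᵐ ω ∂μ, R.actionDist t ω ∈ stdSimplex ℝ ℬ := by
  classical
  by_cases h : t = 0
  · subst h
    filter_upwards [R.bid_first ht] with ω hω
    have h1 : R.actionDist 0 ω = fun b => if b = R.bid 0 ω then 1 else 0 := by
      funext b
      simp only [actionDist, if_true]
      congr 1
      exact propext ⟨fun hb => le_antisymm (hω b) (hb _), fun hb => hb ▸ hω⟩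
    rw [h1]
    refine ⟨fun b => by dsimp only; split_ifs <;> norm_num, by simp⟩
  · filter_upwards [R.bidDist_optimal t ht (Nat.pos_of_ne_zero h)] with ω hω
    obtain ⟨v, x, q, hf, -⟩ := hω
    have h1 : R.actionDist t ω = R.bidDist t ω := by
      funext b
      simp only [actionDist, h, if_false]
    rw [h1]
    exact hf.mem_simplex

lemma past_auction_le {t : ℕ} (ht : t < T) :
    R.ℱ t ⊔ MeasurableSpace.comap (R.auction t) inferInstance ≤ mΩ :=
  sup_le (R.ℱ.le t) (R.auction_meas ht).comap_le

lemma actionDist_law [IsProbabilityMeasure μ] {t : ℕ} (ht : t < T) (b : ℬ) :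
    μ[Set.indicator {ω | R.bid t ω = b} (fun _ => (1 : ℝ)) |
      R.ℱ t ⊔ MeasurableSpace.comap (R.auction t) inferInstance]
      =ᵐ[μ] fun ω => R.actionDist t ω b := by
  classical
  by_cases h : t = 0
  · subst h
    have h1 : Set.indicator {ω | R.bid 0 ω = b} (fun _ => (1 : ℝ))
        =ᵐ[μ] fun _ => if ∀ b' : ℬ, b' ≤ b then 1 else 0 := by
      filter_upwards [R.bid_first ht] with ω hω
      simp only [Set.indicator, Set.mem_ofPred_eq]
      congr 1
      exact propext ⟨fun hb => hb ▸ hω, fun hb => le_antisymm (hb _) (hω b)⟩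
    refine (condExp_congr_ae h1).trans ?_
    rw [condExp_const (R.past_auction_le ht)]
    simp only [actionDist, if_true]
    rfl
  · refine (R.bid_law t ht (Nat.pos_of_ne_zero h) b).trans ?_
    simp only [actionDist, h, if_false]
    rfl

/-- The expectation of a function of the auction and the bid of a round, weighted with a quantity
determined by the past. -/
lemma integral_mul_auction_bid [IsProbabilityMeasure μ] {Z : Ω → ℝ} {t : ℕ} (ht : t < T)
    (hZ : Measurable[R.ℱ t] Z) {K : ℝ} (hZK : ∀ᵐ ω ∂μ, |Z ω| ≤ K)
    {f : Auction ℬ → ℬ → ℝ} (hf : ∀ b, Measurable fun γ => f γ b)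
    {K' : ℝ} (hfK : ∀ᵐ γ ∂P, ∀ b, |f γ b| ≤ K') :
    ∫ ω, Z ω * f (R.auction t ω) (R.bid t ω) ∂μ
      = ∫ ω, Z ω * ∑ b, R.actionDist t ω b * ∫ γ, f γ b ∂P ∂μ := by
  classical
  have hZ' : Measurable Z := hZ.mono (R.ℱ.le _) le_rfl
  have hγ := R.auction_meas ht
  have hset : ∀ b, MeasurableSet {ω | R.bid t ω = b} := fun b =>
    R.bid_meas ht (measurableSet_singleton b)
  have hbound : ∀ b, ∀ᵐ ω ∂μ, |Z ω * f (R.auction t ω) b| ≤ K * K' := fun b => by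
    filter_upwards [hZK, R.ae_auction hfK ht] with ω h1 h2
    rw [abs_mul]
    exact mul_le_mul h1 (h2 b) (abs_nonneg _) ((abs_nonneg _).trans h1)
  have hsplit : ∀ ω, Z ω * f (R.auction t ω) (R.bid t ω) = ∑ b, Z ω * f (R.auction t ω) b *
      Set.indicator {ω | R.bid t ω = b} (fun _ => (1 : ℝ)) ω := by
    intro ω
    simp [Set.indicator]
  have hint : ∀ b, Integrable (fun ω => Z ω * f (R.auction t ω) b *
      Set.indicator {ω | R.bid t ω = b} (fun _ => (1 : ℝ)) ω) μ := fun b => by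
    refine Integrable.of_bound ?_ (K * K') ?_
    · exact ((hZ'.mul ((hf b).comp hγ)).mul
        (measurable_const.indicator (hset b))).aestronglyMeasurable
    · filter_upwards [hbound b] with ω h
      rw [Real.norm_eq_abs, abs_mul]
      refine (mul_le_of_le_one_right (abs_nonneg _) ?_).trans h
      by_cases hb : R.bid t ω = b <;> simp [Set.indicator, hb]
  have hWint : ∀ b, Integrable (fun ω => Z ω * (R.actionDist t ω b * ∫ γ, f γ b ∂P)) μ := by
    intro b
    refine Integrable.of_bound ?_ (K * (1 * |∫ γ, f γ b ∂P|)) ?_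
    · exact (hZ'.mul (((R.measurable_actionDist ht b).mono (R.ℱ.le _) le_rfl).mul_const
        _)).aestronglyMeasurable
    · filter_upwards [hZK, R.ae_actionDist_mem ht] with ω h1 h2
      rw [Real.norm_eq_abs, abs_mul, abs_mul]
      have h3 : |R.actionDist t ω b| ≤ 1 := by
        rw [abs_of_nonneg (h2.1 b), ← h2.2]
        exact Finset.single_le_sum (fun c _ => h2.1 c) (Finset.mem_univ b)
      have := (abs_nonneg _).trans h1
      gcongr
  simp_rw [hsplit, Finset.mul_sum]
  rw [integral_finsetSum _ fun b _ => hint b, integral_finsetSum _ fun b _ => hWint b]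
  refine Finset.sum_congr rfl fun b _ => ?_
  have hY : Measurable[R.ℱ t ⊔ MeasurableSpace.comap (R.auction t) inferInstance]
      fun ω => Z ω * f (R.auction t ω) b :=
    (hZ.mono le_sup_left le_rfl).mul
      ((hf b).comp ((comap_measurable (R.auction t)).mono le_sup_right le_rfl))
  rw [integral_mul_indicator_eq (R.past_auction_le ht) (hset b) (R.actionDist_law ht b) hY
    (hbound b)]
  calc ∫ ω, Z ω * f (R.auction t ω) b * R.actionDist t ω b ∂μ
      = ∫ ω, Z ω * R.actionDist t ω b * f (R.auction t ω) b ∂μ := by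
        congr 1; funext ω; ring
    _ = (∫ ω, Z ω * R.actionDist t ω b ∂μ) * ∫ γ, f γ b ∂P :=
        R.integral_mul_auction (Z := fun ω => Z ω * R.actionDist t ω b) ht
          (hZ.mul (R.measurable_actionDist ht b)) (hf b)
    _ = _ := by
        rw [← integral_mul_const]
        congr 1; funext ω; ring

/-- The indicator of winning round `t`. -/
noncomputable def winInd (t : ℕ) (ω : Ω) : ℝ :=
  Set.indicator {ω | R.win t ω = true} (fun _ => (1 : ℝ)) ω

lemma winInd_mem (t : ℕ) (ω : Ω) : R.winInd t ω = 0 ∨ R.winInd t ω = 1 := by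
  unfold winInd
  exact (Set.indicator_eq_zero_or_self _ _ _)

lemma measurable_winInd {t : ℕ} (ht : t < T) : Measurable[R.ℱ (t + 1)] (R.winInd t) :=
  measurable_const.indicator (R.measurable_win t ht (measurableSet_singleton true))

/-- The expectation of a function of the auction over the rounds that are won, weighted with a
quantity determined by the past. -/
lemma integral_mul_auction_winInd [IsProbabilityMeasure μ] (hP : ∀ᵐ γ ∂P, γ.IsAdmissible)
    {Z : Ω → ℝ} {t : ℕ} (ht : t < T)
    (hZ : Measurable[R.ℱ t] Z) {K : ℝ} (hZK : ∀ᵐ ω ∂μ, |Z ω| ≤ K)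
    {f : Auction ℬ → ℝ} (hf : Measurable f)
    {K' : ℝ} (hfK : ∀ᵐ γ ∂P, |f γ| ≤ K') :
    ∫ ω, Z ω * (f (R.auction t ω) * R.winInd t ω) ∂μ
      = ∫ ω, Z ω * ∑ b, R.actionDist t ω b * ∫ γ, γ.alloc b * f γ ∂P ∂μ := by
  rw [← R.integral_mul_auction_bid ht hZ hZK (f := fun γ b => γ.alloc b * f γ) (K' := K')
    (fun b => (Auction.measurable_alloc b).mul hf)]
  · have hm : R.ℱ t ⊔ MeasurableSpace.comap (R.auction t) inferInstance
        ⊔ MeasurableSpace.comap (R.bid t) inferInstance ≤ mΩ :=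
      sup_le (R.past_auction_le ht) (R.bid_meas ht).comap_le
    have hY : Measurable[R.ℱ t ⊔ MeasurableSpace.comap (R.auction t) inferInstance
        ⊔ MeasurableSpace.comap (R.bid t) inferInstance] fun ω => Z ω * f (R.auction t ω) :=
      (hZ.mono (le_sup_left.trans le_sup_left) le_rfl).mul
        (hf.comp ((comap_measurable (R.auction t)).mono (le_sup_right.trans le_sup_left) le_rfl))
    have hb : ∀ᵐ ω ∂μ, |Z ω * f (R.auction t ω)| ≤ K * K' := by
      filter_upwards [hZK, R.ae_auction hfK ht] with ω h1 h2
      rw [abs_mul]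
      exact mul_le_mul h1 h2 (abs_nonneg _) ((abs_nonneg _).trans h1)
    have hA : MeasurableSet {ω | R.win t ω = true} :=
      R.ℱ.le _ _ (R.measurable_win t ht (measurableSet_singleton true))
    calc _ = ∫ ω, Z ω * f (R.auction t ω) * R.winInd t ω ∂μ := by
          congr 1; funext ω; ring
      _ = _ := integral_mul_indicator_eq hm hA (R.win_law t ht) hY hb
      _ = _ := by congr 1; funext ω; ring
  · filter_upwards [hP, hfK] with γ h1 h2 b
    rw [abs_mul, abs_of_nonneg (h1.alloc_mem b).1]
    exact (mul_le_of_le_one_left (abs_nonneg _) (h1.alloc_mem b).2).trans h2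

end UCBRoSRun

/-! ### Exponential supermartingales -/

lemma integrable_exp_of_abs_le {Ω : Type*} [MeasurableSpace Ω] {μ : Measure Ω}
    [IsFiniteMeasure μ] {Y : Ω → ℝ} (hY : Measurable Y) {K : ℝ} (h : ∀ᵐ ω ∂μ, |Y ω| ≤ K) :
    Integrable (fun ω => Real.exp (Y ω)) μ :=
  Integrable.of_bound (by fun_prop) (Real.exp K) (by
    filter_upwards [h] with ω h
    rw [Real.norm_eq_abs, Real.abs_exp]
    exact Real.exp_le_exp.2 ((le_abs_self _).trans h))

namespace UCBRoSRun

variable {ℬ : Finset ℝ≥0} {Ω : Type*} [mΩ : MeasurableSpace Ω] {μ : Measure Ω}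
  {ρ : ℝ} {T : ℕ} {P : Measure (Auction ℬ)} (R : UCBRoSRun μ ℬ ρ T P)

/-- Deviation of the sum of `f` over the first `t` auctions from its mean. -/
noncomputable def dev (f : Auction ℬ → ℝ) (t : ℕ) (ω : Ω) : ℝ :=
  ∑ s ∈ Finset.range t, (f (R.auction s ω) - ∫ γ, f γ ∂P)

/-- Deviation of the sum of the values observed in the first `t` rounds from its mean. -/
noncomputable def valueDev (t : ℕ) (ω : Ω) : ℝ :=
  ∑ s ∈ Finset.range t, R.winInd s ω * ((R.auction s ω).value - meanValue P)

/-- Number of wins in the first `t` rounds of the run. -/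
abbrev wins (t : ℕ) (ω : Ω) : ℕ := winCount (fun s => R.win s ω) t

lemma cast_wins (t : ℕ) (ω : Ω) : (R.wins t ω : ℝ) = ∑ s ∈ Finset.range t, R.winInd s ω := by
  simp [wins, winCount, winInd, Set.indicator]

lemma wins_succ (t : ℕ) (ω : Ω) :
    R.wins (t + 1) ω = R.wins t ω + if R.win t ω = true then 1 else 0 := by
  unfold wins winCount
  rw [Finset.range_add_one, Finset.filter_insert]
  split_ifs with h
  · rw [Finset.card_insert_of_notMem (by simp)]
  · rfl

lemma wins_le (t : ℕ) (ω : Ω) : R.wins t ω ≤ t :=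
  (Finset.card_filter_le _ _).trans (by simp)

lemma measurable_dev {f : Auction ℬ → ℝ} (hf : Measurable f) {t : ℕ} (ht : t ≤ T) :
    Measurable[R.ℱ t] (R.dev f t) := by
  refine Finset.measurable_sum _ fun s hs => ?_
  have hs' := Finset.mem_range.1 hs
  have h := (R.measurable_auction s (by omega)).mono (R.ℱ.mono (show s + 1 ≤ t by omega)) le_rfl
  exact (hf.comp h).sub_const _

lemma measurable_valueDev {t : ℕ} (ht : t ≤ T) : Measurable[R.ℱ t] (R.valueDev t) := by
  refine Finset.measurable_sum _ fun s hs => ?_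
  have hs' := Finset.mem_range.1 hs
  have hle := R.ℱ.mono (show s + 1 ≤ t by omega)
  have h := (R.measurable_auction s (by omega)).mono hle le_rfl
  exact ((R.measurable_winInd (by omega)).mono hle le_rfl).mul
    ((Auction.measurable_value.comp h).sub_const _)

lemma measurable_cast_wins {t : ℕ} (ht : t ≤ T) :
    Measurable[R.ℱ t] fun ω => (R.wins t ω : ℝ) := by
  simp_rw [cast_wins]
  refine Finset.measurable_sum _ fun s hs => ?_
  have hs' := Finset.mem_range.1 hs
  exact (R.measurable_winInd (by omega)).mono (R.ℱ.mono (show s + 1 ≤ t by omega)) le_rfl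

lemma measurable_wins {t : ℕ} (ht : t ≤ T) : Measurable[R.ℱ t] (R.wins t) := by
  have h := Nat.measurable_floor.comp (R.measurable_cast_wins ht)
  simpa [Function.comp_def] using h

lemma abs_dev_le [IsProbabilityMeasure P] {f : Auction ℬ → ℝ} (hf : Measurable f)
    (hf01 : ∀ᵐ γ ∂P, f γ ∈ Set.Icc (0 : ℝ) 1) {t : ℕ} (ht : t ≤ T) :
    ∀ᵐ ω ∂μ, |R.dev f t ω| ≤ t := by
  have h : ∀ᵐ ω ∂μ, ∀ s : Fin T, f (R.auction s ω) ∈ Set.Icc (0 : ℝ) 1 :=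
    ae_all_iff.2 fun s => R.ae_auction hf01 s.2
  have hm := integral_mem_Icc hf hf01
  filter_upwards [h] with ω hω
  refine (Finset.abs_sum_le_sum_abs _ _).trans ?_
  refine (Finset.sum_le_card_nsmul _ _ 1 fun s hs => ?_).trans (by simp)
  have h1 := hω ⟨s, (Finset.mem_range.1 hs).trans_le ht⟩
  rw [abs_le]
  constructor <;> linarith [h1.1, h1.2, hm.1, hm.2]

lemma meanValue_mem [IsProbabilityMeasure P] (hP : ∀ᵐ γ ∂P, γ.IsAdmissible) :
    meanValue P ∈ Set.Icc (0 : ℝ) 1 :=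
  integral_mem_Icc Auction.measurable_value (hP.mono fun _ h => h.value_mem)

lemma abs_valueDev_le [IsProbabilityMeasure P] (hP : ∀ᵐ γ ∂P, γ.IsAdmissible) {t : ℕ}
    (ht : t ≤ T) : ∀ᵐ ω ∂μ, |R.valueDev t ω| ≤ R.wins t ω := by
  have h : ∀ᵐ ω ∂μ, ∀ s : Fin T, (R.auction s ω).IsAdmissible :=
    ae_all_iff.2 fun s => R.ae_auction hP s.2
  have hm := meanValue_mem hP
  filter_upwards [h] with ω hω
  rw [cast_wins]
  refine (Finset.abs_sum_le_sum_abs _ _).trans (Finset.sum_le_sum fun s hs => ?_)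
  have h1 := (hω ⟨s, (Finset.mem_range.1 hs).trans_le ht⟩).value_mem
  have h2 : |(R.auction s ω).value - meanValue P| ≤ 1 := by
    rw [abs_le]
    constructor <;> linarith [h1.1, h1.2, hm.1, hm.2]
  rcases R.winInd_mem s ω with h3 | h3 <;> rw [h3] <;> simp [h2]

lemma abs_exponent_le {l S n t : ℝ} (hS : |S| ≤ t) (hn : 0 ≤ n) (hnt : n ≤ t) :
    |l * S - l ^ 2 * n / 8| ≤ |l| * t + l ^ 2 * t / 8 := by
  refine (abs_sub _ _).trans ?_
  rw [abs_mul, abs_of_nonneg (show 0 ≤ l ^ 2 * n / 8 by positivity)]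
  gcongr

/-- Hoeffding's moment bound for functions of the first `t` auctions. -/
lemma integral_exp_dev_le [IsProbabilityMeasure μ] [IsProbabilityMeasure P]
    {f : Auction ℬ → ℝ} (hf : Measurable f)
    (hf01 : ∀ᵐ γ ∂P, f γ ∈ Set.Icc (0 : ℝ) 1) (l : ℝ) {t : ℕ} (ht : t ≤ T) :
    ∫ ω, Real.exp (l * R.dev f t ω - l ^ 2 * t / 8) ∂μ ≤ 1 := by
  induction t with
  | zero => simp [dev]
  | succ t ih =>
    set m := ∫ γ, f γ ∂P with hm
    have h1 : ∀ ω, Real.exp (l * R.dev f (t + 1) ω - l ^ 2 * (t + 1 : ℕ) / 8)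
        = Real.exp (l * R.dev f t ω - l ^ 2 * t / 8)
          * Real.exp (l * (f (R.auction t ω) - m) - l ^ 2 / 8) := by
      intro ω
      rw [← Real.exp_add]
      congr 1
      simp only [dev, Finset.sum_range_succ]
      push_cast
      ring
    simp_rw [h1]
    rw [R.integral_mul_auction (Z := fun ω => Real.exp (l * R.dev f t ω - l ^ 2 * t / 8))
      (f := fun γ => Real.exp (l * (f γ - m) - l ^ 2 / 8)) (by omega)
      (Real.measurable_exp.comp (((R.measurable_dev hf (by omega)).const_mul l).sub_const _))
      (by fun_prop)]
    have h2 : ∫ γ, Real.exp (l * (f γ - m) - l ^ 2 / 8) ∂P ≤ 1 := by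
      have h := integral_weight_mul_exp_le hf (measurable_const (a := (1 : ℝ))) hf01 (by simp)
        (integral_mem_Icc hf hf01) (by simp) l
      have hi : Integrable (fun γ => Real.exp (l * (f γ - m) - l ^ 2 / 8)) P := by
        refine integrable_exp_of_abs_le (by fun_prop) (K := |l| * 1 + l ^ 2 * 1 / 8) ?_
        filter_upwards [hf01] with γ hγ
        have hm01 := integral_mem_Icc hf hf01
        have := abs_exponent_le (l := l) (S := f γ - m) (n := 1) (t := 1) (by
          rw [abs_le]; constructor <;> linarith [hγ.1, hγ.2, hm01.1, hm01.2]) (by simp) le_rfl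
        simpa using this
      simp only [one_mul] at h
      rw [integral_sub hi (integrable_const _)] at h
      simpa using h
    exact mul_le_one₀ (ih (by omega)) (integral_nonneg fun _ => (Real.exp_pos _).le) h2

/-- The observed values have the moment bound of a sum of bounded variables with mean `E[v]`, the
variance proxy being the random number of wins. That winning does not bias the mean of the value is
where the absence of correlation between value and allocation enters. -/
lemma integral_exp_valueDev_le [IsProbabilityMeasure μ] [IsProbabilityMeasure P]
    (hP : ∀ᵐ γ ∂P, γ.IsAdmissible)
    (hcor : ∀ b : ℬ, ∫ γ, γ.value * γ.alloc b ∂P = meanValue P * meanAlloc P b)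
    (l : ℝ) {t : ℕ} (ht : t ≤ T) :
    ∫ ω, Real.exp (l * R.valueDev t ω - l ^ 2 * R.wins t ω / 8) ∂μ ≤ 1 := by
  induction t with
  | zero => simp [valueDev, winCount]
  | succ t ih =>
    have htT : t < T := by omega
    set m := meanValue P
    have hm := meanValue_mem hP
    set Z : Ω → ℝ := fun ω => Real.exp (l * R.valueDev t ω - l ^ 2 * R.wins t ω / 8)
    set h : Auction ℬ → ℝ := fun γ => Real.exp (l * (γ.value - m) - l ^ 2 / 8) - 1
    have hhm : Measurable h := by fun_prop
    have h1 : ∀ ω, Real.exp (l * R.valueDev (t + 1) ω - l ^ 2 * R.wins (t + 1) ω / 8)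
        = Z ω + Z ω * (h (R.auction t ω) * R.winInd t ω) := by
      intro ω
      have e : l * R.valueDev (t + 1) ω - l ^ 2 * R.wins (t + 1) ω / 8
          = (l * R.valueDev t ω - l ^ 2 * R.wins t ω / 8)
            + R.winInd t ω * (l * ((R.auction t ω).value - m) - l ^ 2 / 8) := by
        simp only [cast_wins, valueDev, Finset.sum_range_succ]
        ring
      rw [e, Real.exp_add]
      rcases R.winInd_mem t ω with h0 | h0 <;> rw [h0] <;> simp [Z, h]
      ring
    have hexp : ∀ γ : Auction ℬ, γ.IsAdmissible →
        |l * (γ.value - m) - l ^ 2 / 8| ≤ |l| * 1 + l ^ 2 * 1 / 8 := by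
      intro γ hγ
      have hv := hγ.value_mem
      have := abs_exponent_le (l := l) (S := γ.value - m) (n := 1) (t := 1) (by
        rw [abs_le]; constructor <;> linarith [hv.1, hv.2, hm.1, hm.2]) (by simp) le_rfl
      simpa using this
    have hhb : ∀ᵐ γ ∂P, |h γ| ≤ Real.exp (|l| * 1 + l ^ 2 * 1 / 8) + 1 := by
      filter_upwards [hP] with γ hγ
      have h2 := Real.exp_le_exp.2 ((le_abs_self _).trans (hexp γ hγ))
      have h3 := Real.exp_pos (l * (γ.value - m) - l ^ 2 / 8)
      rw [abs_le]
      constructor <;> simp only [h] <;> linarith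
    have hZm : Measurable[R.ℱ t] Z :=
      Real.measurable_exp.comp (((R.measurable_valueDev htT.le).const_mul l).sub
        (((R.measurable_cast_wins htT.le).const_mul _).div_const _))
    have hZe : ∀ᵐ ω ∂μ, |l * R.valueDev t ω - l ^ 2 * R.wins t ω / 8|
        ≤ |l| * t + l ^ 2 * t / 8 := by
      filter_upwards [R.abs_valueDev_le hP htT.le] with ω hω
      have hN : (R.wins t ω : ℝ) ≤ t := by exact_mod_cast R.wins_le t ω
      exact abs_exponent_le (hω.trans hN) (by positivity) hN
    have hZb : ∀ᵐ ω ∂μ, |Z ω| ≤ Real.exp (|l| * t + l ^ 2 * t / 8) := by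
      filter_upwards [hZe] with ω hω
      rw [Real.abs_exp]
      exact Real.exp_le_exp.2 ((le_abs_self _).trans hω)
    have hZ' : Measurable Z := hZm.mono (R.ℱ.le _) le_rfl
    have hZi : Integrable Z μ := Integrable.of_bound hZ'.aestronglyMeasurable _ hZb
    have hZi2 : Integrable (fun ω => Z ω * (h (R.auction t ω) * R.winInd t ω)) μ := by
      refine Integrable.of_bound ?_ (Real.exp (|l| * t + l ^ 2 * t / 8) *
        (Real.exp (|l| * 1 + l ^ 2 * 1 / 8) + 1)) ?_
      · exact (hZ'.mul ((hhm.comp (R.auction_meas htT)).mul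
          ((R.measurable_winInd htT).mono (R.ℱ.le _) le_rfl))).aestronglyMeasurable
      · filter_upwards [hZb, R.ae_auction hhb htT] with ω h2 h3
        rw [Real.norm_eq_abs, abs_mul, abs_mul]
        have h4 : |R.winInd t ω| ≤ 1 := by
          rcases R.winInd_mem t ω with h0 | h0 <;> rw [h0] <;> simp
        have h5 : |h (R.auction t ω)| * |R.winInd t ω| ≤ |h (R.auction t ω)| :=
          mul_le_of_le_one_right (abs_nonneg _) h4
        exact mul_le_mul h2 (h5.trans h3) (by positivity) (by positivity)
    simp_rw [h1]
    rw [integral_add hZi hZi2, R.integral_mul_auction_winInd hP htT hZm hZb hhm hhb]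
    have hneg : ∫ ω, Z ω * ∑ b, R.actionDist t ω b * ∫ γ, γ.alloc b * h γ ∂P ∂μ ≤ 0 := by
      refine integral_nonpos_of_ae ?_
      filter_upwards [R.ae_actionDist_mem htT] with ω hω
      refine mul_nonpos_of_nonneg_of_nonpos (Real.exp_pos _).le
        (Finset.sum_nonpos fun b _ => mul_nonpos_of_nonneg_of_nonpos (hω.1 b) ?_)
      exact integral_weight_mul_exp_le Auction.measurable_value (Auction.measurable_alloc b)
        (hP.mono fun γ hγ => hγ.value_mem) (hP.mono fun γ hγ => hγ.alloc_mem b) hm (hcor b) l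
    linarith [ih htT.le]

lemma integrable_twoSidedExp [IsProbabilityMeasure μ] {S N : Ω → ℝ} (hS : Measurable S)
    (hN : Measurable N) {K : ℝ} (h : ∀ᵐ ω ∂μ, |S ω| ≤ K ∧ 0 ≤ N ω ∧ N ω ≤ K) (l : ℝ) :
    Integrable (fun ω => twoSidedExp l (S ω) (N ω)) μ :=
  (integrable_exp_of_abs_le (by fun_prop)
    (h.mono fun ω h => abs_exponent_le (l := l) h.1 h.2.1 h.2.2)).add
  (integrable_exp_of_abs_le (by fun_prop)
    (h.mono fun ω h => abs_exponent_le (l := -l) h.1 h.2.1 h.2.2))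

lemma integral_twoSidedExp_le [IsProbabilityMeasure μ] {S N : Ω → ℝ} (hS : Measurable S)
    (hN : Measurable N) {K : ℝ} (h : ∀ᵐ ω ∂μ, |S ω| ≤ K ∧ 0 ≤ N ω ∧ N ω ≤ K)
    (h1 : ∀ l : ℝ, ∫ ω, Real.exp (l * S ω - l ^ 2 * N ω / 8) ∂μ ≤ 1) (l : ℝ) :
    ∫ ω, twoSidedExp l (S ω) (N ω) ∂μ ≤ 2 := by
  unfold twoSidedExp
  rw [integral_add]
  · linarith [h1 l, h1 (-l)]
  · exact integrable_exp_of_abs_le (by fun_prop)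
      (h.mono fun ω h => abs_exponent_le (l := l) h.1 h.2.1 h.2.2)
  · exact integrable_exp_of_abs_le (by fun_prop)
      (h.mono fun ω h => abs_exponent_le (l := -l) h.1 h.2.1 h.2.2)

end UCBRoSRun

/-! ### The confidence sets contain the truth -/

namespace UCBRoSRun

variable {ℬ : Finset ℝ≥0} {Ω : Type*} [mΩ : MeasurableSpace Ω] {μ : Measure Ω}
  {ρ : ℝ} {T : ℕ} {P : Measure (Auction ℬ)} (R : UCBRoSRun μ ℬ ρ T P)

/-- A nonnegative random variable that is at least `1` whenever one of the confidence sets after `t`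
rounds misses the true parameter. Its expectation bounds the probability of this event. The first
sum handles allocation and price, the second one the value, with `j + 1` in the role of the integer
part of the root of the number of wins. -/
noncomputable def failBound (t : ℕ) (ω : Ω) : ℝ :=
  ∑ b : ℬ, 1 / (2 * (ℬ.card : ℝ) * T) *
    (twoSidedExp (4 * functionRadius ℬ T t) (R.dev (fun γ => γ.alloc b) t ω) t +
      twoSidedExp (4 * functionRadius ℬ T t) (R.dev (fun γ => γ.paid b) t ω) t) +
  ∑ j ∈ Finset.range (Nat.sqrt T), Real.exp 8 / (2 * T) *
    twoSidedExp (4 * √(Real.log (2 * T) / 2) / (j + 1 : ℕ)) (R.valueDev t ω) (R.wins t ω)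

lemma failBound_nonneg (t : ℕ) (ω : Ω) : 0 ≤ R.failBound t ω := by
  unfold failBound
  have := twoSidedExp_nonneg
  refine add_nonneg (Finset.sum_nonneg fun b _ => mul_nonneg (by positivity)
    (add_nonneg (this _ _ _) (this _ _ _))) (Finset.sum_nonneg fun j _ =>
      mul_nonneg (by positivity) (this _ _ _))

lemma dev_eq (f : Auction ℬ → ℝ) (t : ℕ) (ω : Ω) :
    R.dev f t ω = ∑ s ∈ Finset.range t, f (R.auction s ω) - t * ∫ γ, f γ ∂P := by
  simp [dev, Finset.sum_sub_distrib]

lemma abs_mean_sub_avg (f : Auction ℬ → ℝ) {t : ℕ} (ht : 0 < t) (ω : Ω) :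
    |∫ γ, f γ ∂P - (∑ s ∈ Finset.range t, f (R.auction s ω)) / t| = |R.dev f t ω| / t := by
  have ht' : (0 : ℝ) < t := by exact_mod_cast ht
  rw [dev_eq, abs_sub_comm]
  nth_rewrite 3 [← abs_of_pos ht']
  rw [← abs_div]
  congr 1
  field_simp

lemma sum_observed_value (t : ℕ) (ω : Ω) :
    ∑ s ∈ (Finset.range t).filter (fun s => R.win s ω = true), (R.auction s ω).value
      = R.valueDev t ω + R.wins t ω * meanValue P := by
  rw [cast_wins, valueDev, Finset.sum_mul, ← Finset.sum_add_distrib, Finset.sum_filter]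
  refine Finset.sum_congr rfl fun s _ => ?_
  by_cases h : R.win s ω = true <;> simp [winInd, Set.indicator, h]

lemma abs_meanValue_sub_valueEst {t : ℕ} {ω : Ω} (h : 0 < R.wins t ω) :
    |meanValue P - valueEst (fun s => R.auction s ω) (fun s => R.win s ω) t|
      = |R.valueDev t ω| / R.wins t ω := by
  have h' : (0 : ℝ) < R.wins t ω := by exact_mod_cast h
  rw [valueEst, sum_observed_value, abs_sub_comm]
  nth_rewrite 3 [← abs_of_pos h']
  rw [← abs_div]
  congr 1
  change (R.valueDev t ω + R.wins t ω * meanValue P) / (R.wins t ω : ℝ) - meanValue P = _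
  field_simp
  ring

lemma log_two_mul_nonneg {c : ℝ} (h : 1 ≤ c) : 0 ≤ Real.log (2 * c) := Real.log_nonneg (by linarith)

lemma one_le_failBound_of_function {t : ℕ} (ht : 0 < t) (hT : 0 < T) {ω : Ω} {b : ℬ}
    {f : Auction ℬ → ℝ} (hf : f = (fun γ => γ.alloc b) ∨ f = (fun γ => γ.paid b))
    (h : functionRadius ℬ T t
      < |∫ γ, f γ ∂P - (∑ s ∈ Finset.range t, f (R.auction s ω)) / t|) :
    1 ≤ R.failBound t ω := by
  have hB : (1 : ℝ) ≤ ℬ.card := by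
    exact_mod_cast Nat.one_le_iff_ne_zero.2 (Finset.card_ne_zero_of_mem b.2)
  have hT' : (1 : ℝ) ≤ T := by exact_mod_cast hT
  have hBT : (1 : ℝ) ≤ 2 * (ℬ.card : ℝ) * T := by nlinarith
  rw [R.abs_mean_sub_avg f ht ω] at h
  have h1 := exp_le_twoSidedExp_of_lt (by exact_mod_cast ht) (Real.log_nonneg hBT) h
  rw [Real.exp_log (by linarith)] at h1
  have h2 : (1 : ℝ) ≤ 1 / (2 * (ℬ.card : ℝ) * T) *
      twoSidedExp (4 * functionRadius ℬ T t) (R.dev f t ω) t := by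
    rw [one_div, ← div_eq_inv_mul, one_le_div (by linarith)]
    exact h1
  have hn := twoSidedExp_nonneg
  have h0 : 0 ≤ 1 / (2 * (ℬ.card : ℝ) * T) := by positivity
  have h3 : 1 / (2 * (ℬ.card : ℝ) * T) *
      twoSidedExp (4 * functionRadius ℬ T t) (R.dev f t ω) t ≤ 1 / (2 * (ℬ.card : ℝ) * T) *
    (twoSidedExp (4 * functionRadius ℬ T t) (R.dev (fun γ => γ.alloc b) t ω) t +
      twoSidedExp (4 * functionRadius ℬ T t) (R.dev (fun γ => γ.paid b) t ω) t) := by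
    refine mul_le_mul_of_nonneg_left ?_ h0
    rcases hf with rfl | rfl
    · exact le_add_of_nonneg_right (hn _ _ _)
    · exact le_add_of_nonneg_left (hn _ _ _)
  refine h2.trans (h3.trans ?_)
  unfold failBound
  refine le_add_of_le_of_nonneg ?_ (Finset.sum_nonneg fun j _ =>
    mul_nonneg (by positivity) (hn _ _ _))
  exact Finset.single_le_sum (f := fun b : ℬ => 1 / (2 * (ℬ.card : ℝ) * T) *
    (twoSidedExp (4 * functionRadius ℬ T t) (R.dev (fun γ => γ.alloc b) t ω) t +
      twoSidedExp (4 * functionRadius ℬ T t) (R.dev (fun γ => γ.paid b) t ω) t))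
    (fun b _ => mul_nonneg h0 (add_nonneg (hn _ _ _) (hn _ _ _))) (Finset.mem_univ b)

lemma one_le_failBound_of_value {t : ℕ} (htT : t ≤ T) {ω : Ω}
    (hdev : |R.valueDev t ω| ≤ R.wins t ω) (hN : 0 < R.wins t ω)
    (h : √(Real.log (2 * T) / (2 * R.wins t ω))
      < |meanValue P - valueEst (fun s => R.auction s ω) (fun s => R.win s ω) t|) :
    1 ≤ R.failBound t ω := by
  have hNT : R.wins t ω ≤ T := (R.wins_le t ω).trans htT
  have hT' : (1 : ℝ) ≤ T := by exact_mod_cast hN.trans_le hNT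
  rw [R.abs_meanValue_sub_valueEst hN] at h
  have h1 := exp_sub_le_twoSidedExp_of_lt hN (log_two_mul_nonneg hT') hdev h
  rw [Real.exp_sub, Real.exp_log (by linarith)] at h1
  set j := Nat.sqrt (R.wins t ω) with hj
  have hj1 : 0 < j := Nat.sqrt_pos.2 hN
  have hj2 : j ≤ Nat.sqrt T := Nat.sqrt_le_sqrt hNT
  have hn := twoSidedExp_nonneg
  have h2 : (1 : ℝ) ≤ Real.exp 8 / (2 * T) *
      twoSidedExp (4 * √(Real.log (2 * T) / 2) / j) (R.valueDev t ω) (R.wins t ω) := by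
    calc (1 : ℝ) = Real.exp 8 / (2 * T) * (2 * T / Real.exp 8) := by
          have := Real.exp_pos 8
          field_simp
      _ ≤ _ := mul_le_mul_of_nonneg_left h1 (by positivity)
  have h3 := Finset.single_le_sum (f := fun j : ℕ => Real.exp 8 / (2 * T) *
      twoSidedExp (4 * √(Real.log (2 * T) / 2) / (j + 1 : ℕ)) (R.valueDev t ω) (R.wins t ω))
    (s := Finset.range (Nat.sqrt T)) (fun j _ => mul_nonneg (by positivity) (hn _ _ _))
    (Finset.mem_range.2 (show j - 1 < Nat.sqrt T by omega))
  simp only [Nat.sub_add_cancel hj1] at h3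
  refine h2.trans (h3.trans ?_)
  unfold failBound
  refine le_add_of_nonneg_left (Finset.sum_nonneg fun b _ => mul_nonneg (by positivity)
    (add_nonneg (hn _ _ _) (hn _ _ _)))

lemma ae_twoSided_dev [IsProbabilityMeasure P] {f : Auction ℬ → ℝ} (hf : Measurable f)
    (hf01 : ∀ᵐ γ ∂P, f γ ∈ Set.Icc (0 : ℝ) 1) {t : ℕ} (ht : t ≤ T) :
    ∀ᵐ ω ∂μ, |R.dev f t ω| ≤ t ∧ (0 : ℝ) ≤ t ∧ (t : ℝ) ≤ t := by
  filter_upwards [R.abs_dev_le hf hf01 ht] with ω h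
  exact ⟨h, by positivity, le_rfl⟩

lemma ae_twoSided_valueDev [IsProbabilityMeasure P] (hP : ∀ᵐ γ ∂P, γ.IsAdmissible) {t : ℕ}
    (ht : t ≤ T) :
    ∀ᵐ ω ∂μ, |R.valueDev t ω| ≤ t ∧ (0 : ℝ) ≤ R.wins t ω ∧ (R.wins t ω : ℝ) ≤ t := by
  filter_upwards [R.abs_valueDev_le hP ht] with ω h
  have hN : (R.wins t ω : ℝ) ≤ t := by exact_mod_cast R.wins_le t ω
  exact ⟨h.trans hN, by positivity, hN⟩

section Expectation

variable [IsProbabilityMeasure μ] [IsProbabilityMeasure P]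

lemma integral_twoSided_dev {f : Auction ℬ → ℝ} (hf : Measurable f)
    (hf01 : ∀ᵐ γ ∂P, f γ ∈ Set.Icc (0 : ℝ) 1) {t : ℕ} (ht : t ≤ T) (l : ℝ) :
    Integrable (fun ω => twoSidedExp l (R.dev f t ω) t) μ ∧
      ∫ ω, twoSidedExp l (R.dev f t ω) t ∂μ ≤ 2 := by
  have hm := (R.measurable_dev hf ht).mono (R.ℱ.le _) le_rfl
  exact ⟨integrable_twoSidedExp hm measurable_const (R.ae_twoSided_dev hf hf01 ht) l,
    integral_twoSidedExp_le hm measurable_const (R.ae_twoSided_dev hf hf01 ht)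
      (fun l => R.integral_exp_dev_le hf hf01 l ht) l⟩

lemma integral_twoSided_valueDev (hP : ∀ᵐ γ ∂P, γ.IsAdmissible)
    (hcor : ∀ b : ℬ, ∫ γ, γ.value * γ.alloc b ∂P = meanValue P * meanAlloc P b)
    {t : ℕ} (ht : t ≤ T) (l : ℝ) :
    Integrable (fun ω => twoSidedExp l (R.valueDev t ω) (R.wins t ω)) μ ∧
      ∫ ω, twoSidedExp l (R.valueDev t ω) (R.wins t ω) ∂μ ≤ 2 := by
  have hm := (R.measurable_valueDev ht).mono (R.ℱ.le _) le_rfl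
  have hN := (R.measurable_cast_wins ht).mono (R.ℱ.le _) le_rfl
  exact ⟨integrable_twoSidedExp hm hN (R.ae_twoSided_valueDev hP ht) l,
    integral_twoSidedExp_le hm hN (R.ae_twoSided_valueDev hP ht)
      (fun l => R.integral_exp_valueDev_le hP hcor l ht) l⟩

lemma integrable_failBound (hP : ∀ᵐ γ ∂P, γ.IsAdmissible)
    (hcor : ∀ b : ℬ, ∫ γ, γ.value * γ.alloc b ∂P = meanValue P * meanAlloc P b)
    {t : ℕ} (ht : t ≤ T) : Integrable (R.failBound t) μ := by
  have ha := fun b => (R.integral_twoSided_dev (Auction.measurable_alloc b)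
    (hP.mono fun _ h => h.alloc_mem b) ht (4 * functionRadius ℬ T t)).1
  have hp := fun b => (R.integral_twoSided_dev (Auction.measurable_paid b)
    (hP.mono fun _ h => h.paid_mem b) ht (4 * functionRadius ℬ T t)).1
  exact (integrable_finsetSum _ fun b _ => ((ha b).add (hp b)).const_mul _).add
    (integrable_finsetSum _ fun j _ => (R.integral_twoSided_valueDev hP hcor ht _).1.const_mul _)

/-- A confidence set after `t` rounds misses the true parameter with probability `O(1 / √T)`. The
random number of wins costs the factor `√T` compared with a fixed sample size. -/
lemma integral_failBound_le (hP : ∀ᵐ γ ∂P, γ.IsAdmissible)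
    (hcor : ∀ b : ℬ, ∫ γ, γ.value * γ.alloc b ∂P = meanValue P * meanAlloc P b)
    (hB : 0 < ℬ.card) {t : ℕ} (ht : t ≤ T) :
    ∫ ω, R.failBound t ω ∂μ ≤ 2 / T + Real.exp 8 * √T / T := by
  have ha := fun b => R.integral_twoSided_dev (Auction.measurable_alloc b)
    (hP.mono fun _ h => h.alloc_mem b) ht (4 * functionRadius ℬ T t)
  have hp := fun b => R.integral_twoSided_dev (Auction.measurable_paid b)
    (hP.mono fun _ h => h.paid_mem b) ht (4 * functionRadius ℬ T t)
  have hv := R.integral_twoSided_valueDev hP hcor ht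
  have hB' : (0 : ℝ) < ℬ.card := by exact_mod_cast hB
  have hap : ∀ b, Integrable (fun ω => 1 / (2 * (ℬ.card : ℝ) * T) *
      (twoSidedExp (4 * functionRadius ℬ T t) (R.dev (fun γ => γ.alloc b) t ω) t +
        twoSidedExp (4 * functionRadius ℬ T t) (R.dev (fun γ => γ.paid b) t ω) t)) μ :=
    fun b => ((ha b).1.add (hp b).1).const_mul _
  unfold failBound
  rw [integral_add (integrable_finsetSum _ fun b _ => hap b)
    (integrable_finsetSum _ fun j _ => (hv _).1.const_mul _),
    integral_finsetSum _ fun b _ => hap b,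
    integral_finsetSum _ fun j _ => (hv _).1.const_mul _]
  simp_rw [integral_const_mul]
  refine add_le_add ?_ ?_
  · calc _ ≤ ∑ b : ℬ, 1 / (2 * (ℬ.card : ℝ) * T) * 4 := by
          refine Finset.sum_le_sum fun b _ => mul_le_mul_of_nonneg_left ?_ (by positivity)
          rw [integral_add (ha b).1 (hp b).1]
          linarith [(ha b).2, (hp b).2]
      _ = 2 / T := by
          rw [Finset.sum_const, Finset.card_univ, Fintype.card_coe, nsmul_eq_mul]
          field_simp
          ring
  · calc _ ≤ ∑ j ∈ Finset.range (Nat.sqrt T), Real.exp 8 / (2 * T) * 2 :=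
          Finset.sum_le_sum fun j _ => mul_le_mul_of_nonneg_left (hv _).2 (by positivity)
      _ = Real.exp 8 * (Nat.sqrt T) / T := by
          rw [Finset.sum_const, Finset.card_range, nsmul_eq_mul]
          field_simp
      _ ≤ _ := by
          gcongr
          exact Real.nat_sqrt_le_real_sqrt

end Expectation

/-! ### The loss of a round -/

lemma monotone_mean [IsProbabilityMeasure P] {f : Auction ℬ → ℬ → ℝ}
    (hf : ∀ b, Measurable fun γ => f γ b) (h01 : ∀ b, ∀ᵐ γ ∂P, f γ b ∈ Set.Icc (0 : ℝ) 1)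
    (hmono : ∀ᵐ γ ∂P, Monotone (f γ)) : Monotone fun b => ∫ γ, f γ b ∂P :=
  fun b b' hb => integral_mono_ae (integrable_of_mem_Icc (hf b) (h01 b))
    (integrable_of_mem_Icc (hf b') (h01 b')) (hmono.mono fun _ h => h hb)

/-- Widths of the confidence sets after `t` rounds, the one for the value being weighted with the
conditional probability of winning the next round. -/
noncomputable def width (t : ℕ) (ω : Ω) : ℝ :=
  4 * functionRadius ℬ T t
    + valueWidth T (R.wins t ω) * ∑ b, R.actionDist t ω b * meanAlloc P b

lemma lpValue_le_of_feasible {r : ℝ} (hr : 0 ≤ r)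
    (h : ∀ w, IsFeasible ρ w (meanValue P) (meanAlloc P) (meanPaid P) →
      gain w (meanValue P) (meanAlloc P) ≤ r) : lpValue ρ P ≤ r := by
  refine Real.sSup_le ?_ hr
  rintro _ ⟨w, hw, rfl⟩
  exact h w hw

lemma meanAlloc_mem [IsProbabilityMeasure P] (hP : ∀ᵐ γ ∂P, γ.IsAdmissible) (b : ℬ) :
    meanAlloc P b ∈ Set.Icc (0 : ℝ) 1 :=
  integral_mem_Icc (Auction.measurable_alloc b) (hP.mono fun _ h => h.alloc_mem b)

lemma meanPaid_mem [IsProbabilityMeasure P] (hP : ∀ᵐ γ ∂P, γ.IsAdmissible) (b : ℬ) :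
    meanPaid P b ∈ Set.Icc (0 : ℝ) 1 :=
  integral_mem_Icc (Auction.measurable_paid b) (hP.mono fun _ h => h.paid_mem b)

lemma gain_nonneg [IsProbabilityMeasure P] (hP : ∀ᵐ γ ∂P, γ.IsAdmissible) {w : ℬ → ℝ}
    (hw : w ∈ stdSimplex ℝ ℬ) : 0 ≤ gain w (meanValue P) (meanAlloc P) :=
  Finset.sum_nonneg fun b _ => mul_nonneg (mul_nonneg (hw.1 b) (meanValue_mem hP).1)
    (meanAlloc_mem hP b).1

lemma gain_le_meanValue [IsProbabilityMeasure P] (hP : ∀ᵐ γ ∂P, γ.IsAdmissible) {w : ℬ → ℝ}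
    (hw : w ∈ stdSimplex ℝ ℬ) : gain w (meanValue P) (meanAlloc P) ≤ meanValue P := by
  calc gain w (meanValue P) (meanAlloc P) ≤ ∑ b, w b * meanValue P :=
        Finset.sum_le_sum fun b _ => mul_le_of_le_one_right
          (mul_nonneg (hw.1 b) (meanValue_mem hP).1) (meanAlloc_mem hP b).2
    _ = meanValue P := by rw [← Finset.sum_mul, hw.2, one_mul]

lemma lpValue_le_meanValue [IsProbabilityMeasure P] (hP : ∀ᵐ γ ∂P, γ.IsAdmissible) :
    lpValue ρ P ≤ meanValue P :=
  lpValue_le_of_feasible (meanValue_mem hP).1 fun _ hw => gain_le_meanValue hP hw.mem_simplex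

lemma width_nonneg [IsProbabilityMeasure P] (hP : ∀ᵐ γ ∂P, γ.IsAdmissible) {t : ℕ} {ω : Ω}
    (hw : R.actionDist t ω ∈ stdSimplex ℝ ℬ) : 0 ≤ R.width t ω :=
  add_nonneg (mul_nonneg (by norm_num) (functionRadius_nonneg _ _ _))
    (mul_nonneg (valueWidth_nonneg _ _)
      (Finset.sum_nonneg fun b _ => mul_nonneg (hw.1 b) (meanAlloc_mem hP b).1))

/-- In every round but the first, the expected loss with respect to each of the three criteria is
at most the widths of the confidence sets, up to the event that these miss the truth. -/
lemma ae_round_bounds [IsProbabilityMeasure P] (hP : ∀ᵐ γ ∂P, γ.IsAdmissible)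
    (hρ : 0 < ρ) {t : ℕ} (ht : 0 < t) (htT : t < T) :
    ∀ᵐ ω ∂μ,
      lpValue ρ P - gain (R.actionDist t ω) (meanValue P) (meanAlloc P)
          ≤ R.failBound t ω + R.width t ω ∧
      spend (R.actionDist t ω) (meanPaid P) - gain (R.actionDist t ω) (meanValue P) (meanAlloc P)
          ≤ R.failBound t ω + R.width t ω ∧
      spend (R.actionDist t ω) (meanPaid P) - ρ ≤ R.failBound t ω + R.width t ω := by
  filter_upwards [R.bidDist_optimal t htT ht, R.ae_actionDist_mem htT,
    R.abs_valueDev_le hP htT.le] with ω hopt hw hdev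
  have hF0 := R.failBound_nonneg t ω
  have hW0 := R.width_nonneg hP hw
  have hg0 := gain_nonneg hP hw
  have hv := meanValue_mem hP
  by_cases hF : 1 ≤ R.failBound t ω
  -- If a confidence set may miss the truth, then each of the losses is at most `1` anyway.
  · have hs : spend (R.actionDist t ω) (meanPaid P) ≤ 1 := by
      rw [← hw.2]
      exact Finset.sum_le_sum fun b _ => mul_le_of_le_one_right (hw.1 b) (meanPaid_mem hP b).2
    have hV := lpValue_le_meanValue (ρ := ρ) hP
    refine ⟨?_, ?_, ?_⟩ <;> linarith [hv.2]
  · have hact : R.actionDist t ω = R.bidDist t ω := by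
      funext b
      simp only [actionDist, ht.ne', if_false]
    have hT : 0 < T := by omega
    have hx : meanAlloc P ∈ functionConf T t (allocEst (fun s => R.auction s ω) t) := by
      refine ⟨monotone_mean Auction.measurable_alloc (fun b => hP.mono fun _ h => h.alloc_mem b)
        (hP.mono fun _ h => h.alloc_mono), meanAlloc_mem hP, fun b => ?_⟩
      by_contra hb
      exact hF (R.one_le_failBound_of_function ht hT (b := b) (Or.inl rfl) (not_le.1 hb))
    have hq : meanPaid P ∈ functionConf T t (paidEst (fun s => R.auction s ω) t) := by
      refine ⟨monotone_mean Auction.measurable_paid (fun b => hP.mono fun _ h => h.paid_mem b)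
        (hP.mono fun _ h => h.paid_mono), meanPaid_mem hP, fun b => ?_⟩
      by_contra hb
      exact hF (R.one_le_failBound_of_function ht hT (b := b) (Or.inr rfl) (not_le.1 hb))
    have hvc : meanValue P ∈ valueConf T (winCount (fun s => R.win s ω) t)
        (valueEst (fun s => R.auction s ω) (fun s => R.win s ω) t) := by
      refine ⟨hv, fun hN => ?_⟩
      by_contra hb
      exact hF (R.one_le_failBound_of_value htT.le hdev hN (not_le.1 hb))
    obtain ⟨h1, h2, h3⟩ := hopt.bounds hx hq hvc
    rw [← hact] at h1 h2 h3
    have h1' := lpValue_le_of_feasible (ρ := ρ) (add_nonneg hg0 hW0) h1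
    change spend (R.actionDist t ω) (meanPaid P)
      ≤ gain (R.actionDist t ω) (meanValue P) (meanAlloc P) + R.width t ω at h2
    change spend (R.actionDist t ω) (meanPaid P) ≤ ρ + R.width t ω at h3
    refine ⟨?_, ?_, ?_⟩ <;> linarith

end UCBRoSRun

/-! ### Summing over the rounds -/

lemma sum_sqrt_div_le (L : ℝ) (T : ℕ) :
    ∑ t ∈ Finset.range T, √(L / (2 * t)) ≤ 2 * √(L / 2) * √T := by
  cases T with
  | zero => simp
  | succ T =>
    rw [Finset.sum_range_succ']
    have h : ∀ t : ℕ, √(L / (2 * (t + 1 : ℕ))) = √(L / 2) * (1 / √((t : ℝ) + 1)) := by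
      intro t
      rw [← div_div, Real.sqrt_div' _ (by positivity)]
      push_cast
      ring
    simp_rw [h, ← Finset.mul_sum]
    simp only [Nat.cast_zero, mul_zero, div_zero, Real.sqrt_zero, add_zero]
    calc _ ≤ √(L / 2) * (2 * √(T : ℝ)) :=
          mul_le_mul_of_nonneg_left (sum_inv_sqrt_le T) (Real.sqrt_nonneg _)
      _ = 2 * √(L / 2) * √(T : ℝ) := by ring
      _ ≤ _ := by gcongr; simp

lemma sum_valueWidth_le (T : ℕ) :
    ∑ n ∈ Finset.range T, valueWidth T n ≤ 1 + 4 * √(Real.log (2 * T) / 2) * √T := by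
  calc ∑ n ∈ Finset.range T, valueWidth T n
      ≤ ∑ n ∈ Finset.range T, ((if n = 0 then 1 else 0) + 2 * √(Real.log (2 * T) / (2 * n))) := by
        refine Finset.sum_le_sum fun n _ => ?_
        unfold valueWidth
        split_ifs with h
        · have := Real.sqrt_nonneg (Real.log (2 * T) / (2 * n))
          linarith
        · linarith
    _ ≤ 1 + 2 * (2 * √(Real.log (2 * T) / 2) * √T) := by
        rw [Finset.sum_add_distrib, ← Finset.mul_sum]
        refine add_le_add ?_ (mul_le_mul_of_nonneg_left (sum_sqrt_div_le _ _) (by norm_num))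
        rw [Finset.sum_ite_eq']
        split_ifs <;> norm_num
    _ = _ := by ring

/-- The total loss as `integral_sum_le` bounds it is of order `√(T log (|ℬ| T))`. -/
lemma total_width_le {B T : ℕ} (hB : 0 < B) (hT : 0 < T) (hBT : 2 ≤ B * T) :
    1 + T * (2 / T + Real.exp 8 * √T / T)
        + 4 * ∑ t ∈ Finset.range T, √(Real.log (2 * (B : ℝ) * T) / (2 * t))
        + ∑ n ∈ Finset.range T, valueWidth T n
      ≤ (20 + 2 * Real.exp 8) * √(T * Real.log (B * T)) := by
  have hB' : (1 : ℝ) ≤ B := by exact_mod_cast hB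
  have hT' : (1 : ℝ) ≤ T := by exact_mod_cast hT
  have hBT' : (2 : ℝ) ≤ B * T := by exact_mod_cast hBT
  set l := Real.log ((B : ℝ) * T) with hl
  have hl2 : Real.log 2 ≤ l := Real.log_le_log (by norm_num) hBT'
  have hl4 : 1 / 4 ≤ l := by linarith [Real.log_two_gt_d9]
  have hlog : Real.log (2 * (B : ℝ) * T) ≤ 2 * l := by
    rw [mul_assoc, Real.log_mul (by norm_num) (by positivity)]
    linarith
  have hlog' : Real.log (2 * (T : ℝ)) ≤ 2 * l := by
    refine le_trans (Real.log_le_log (by positivity) ?_) hlog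
    nlinarith
  have h1 : √(Real.log (2 * (B : ℝ) * T) / 2) ≤ √l := Real.sqrt_le_sqrt (by linarith)
  have h2 : √(Real.log (2 * (T : ℝ)) / 2) ≤ √l := Real.sqrt_le_sqrt (by linarith)
  have h3 := sum_sqrt_div_le (Real.log (2 * (B : ℝ) * T)) T
  have h4 := sum_valueWidth_le T
  have hsl : 1 / 2 ≤ √l := Real.le_sqrt_of_sq_le (by linarith)
  have hsT : 1 ≤ √(T : ℝ) := Real.one_le_sqrt.2 hT'
  have hE := Real.exp_pos 8
  rw [Real.sqrt_mul (by positivity)]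
  have h5 : T * (2 / T + Real.exp 8 * √T / T) = 2 + Real.exp 8 * √T := by
    field_simp
  rw [h5]
  set s := √(T : ℝ)
  have h6 : 2 * √(Real.log (2 * (B : ℝ) * T) / 2) * s ≤ 2 * √l * s := by gcongr
  have h7 : 4 * √(Real.log (2 * (T : ℝ)) / 2) * s ≤ 4 * √l * s := by gcongr
  have h8 : s ≤ 2 * (s * √l) := by nlinarith
  have h9 : Real.exp 8 * s ≤ Real.exp 8 * (2 * (s * √l)) := by gcongr
  nlinarith

namespace UCBRoSRun

variable {ℬ : Finset ℝ≥0} {Ω : Type*} [mΩ : MeasurableSpace Ω] {μ : Measure Ω}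
  {ρ : ℝ} {T : ℕ} {P : Measure (Auction ℬ)} (R : UCBRoSRun μ ℬ ρ T P)

/-- Every win is charged with the width belonging to the number of earlier wins, and this number
takes each value at most once over the rounds that are won. -/
lemma sum_valueWidth_mul_winInd (S t : ℕ) (ω : Ω) :
    ∑ s ∈ Finset.range t, valueWidth S (R.wins s ω) * R.winInd s ω
      = ∑ n ∈ Finset.range (R.wins t ω), valueWidth S n := by
  induction t with
  | zero => simp [winCount]
  | succ t ih =>
    rw [Finset.sum_range_succ, ih, wins_succ]
    by_cases h : R.win t ω = true
    · simp [winInd, Set.indicator, h, Finset.sum_range_succ]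
    · simp [winInd, Set.indicator, h]

lemma abs_valueWidth_wins_le (t : ℕ) (ω : Ω) :
    |valueWidth T (R.wins t ω)| ≤ ∑ k ∈ Finset.range (t + 1), valueWidth T k := by
  rw [abs_of_nonneg (valueWidth_nonneg _ _)]
  exact Finset.single_le_sum (f := valueWidth T) (fun _ _ => valueWidth_nonneg _ _)
    (Finset.mem_range.2 (Nat.lt_succ_of_le (R.wins_le t ω)))

lemma measurable_valueWidth_wins {t : ℕ} (ht : t ≤ T) :
    Measurable[R.ℱ t] fun ω => valueWidth T (R.wins t ω) :=
  (measurable_from_top (f := valueWidth T)).comp (R.measurable_wins ht)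

lemma ae_loss_bounds (hP : ∀ᵐ γ ∂P, γ.IsAdmissible) :
    ∀ᵐ γ ∂P, ∀ b : ℬ, (γ.paid b ∈ Set.Icc (0 : ℝ) 1) ∧
      γ.value * γ.alloc b ∈ Set.Icc (0 : ℝ) 1 := by
  filter_upwards [hP] with γ h b
  exact ⟨h.paid_mem b, mul_nonneg h.value_mem.1 (h.alloc_mem b).1,
    mul_le_one₀ h.value_mem.2 (h.alloc_mem b).1 (h.alloc_mem b).2⟩

lemma integrable_auction_bid [IsProbabilityMeasure μ] {t : ℕ} (ht : t < T)
    {d : Auction ℬ → ℬ → ℝ} (hd : ∀ b, Measurable fun γ => d γ b)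
    {K : ℝ} (hdK : ∀ᵐ γ ∂P, ∀ b, |d γ b| ≤ K) :
    Integrable (fun ω => d (R.auction t ω) (R.bid t ω)) μ := by
  refine Integrable.of_bound ?_ K ?_
  · have hm : Measurable fun p : Auction ℬ × ℬ => d p.1 p.2 :=
      measurable_from_prod_countable_left hd
    exact (hm.comp ((R.auction_meas ht).prodMk (R.bid_meas ht))).aestronglyMeasurable
  · filter_upwards [R.ae_auction hdK ht] with ω h
    exact h _

lemma integrable_valueWidth_mul_winInd [IsProbabilityMeasure μ] {t : ℕ} (ht : t < T) :
    Integrable (fun ω => valueWidth T (R.wins t ω) * R.winInd t ω) μ := by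
  refine Integrable.of_bound ?_ (∑ k ∈ Finset.range (t + 1), valueWidth T k) ?_
  · exact (((R.measurable_valueWidth_wins ht.le).mono (R.ℱ.le _) le_rfl).mul
      ((R.measurable_winInd ht).mono (R.ℱ.le _) le_rfl)).aestronglyMeasurable
  · refine Filter.Eventually.of_forall fun ω => ?_
    rw [Real.norm_eq_abs, abs_mul]
    refine (mul_le_of_le_one_right (abs_nonneg _) ?_).trans (R.abs_valueWidth_wins_le t ω)
    rcases R.winInd_mem t ω with h | h <;> rw [h] <;> simp

lemma integrable_reward [IsProbabilityMeasure μ] (hP : ∀ᵐ γ ∂P, γ.IsAdmissible) :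
    Integrable R.reward μ :=
  integrable_finsetSum _ fun t ht => R.integrable_auction_bid (Finset.mem_range.1 ht)
    (d := fun γ b => γ.value * γ.alloc b) (K := 1)
    (fun b => Auction.measurable_value.mul (Auction.measurable_alloc b))
    ((ae_loss_bounds hP).mono fun γ h b => by
      rw [abs_of_nonneg (h b).2.1]; exact (h b).2.2)

lemma regret_eq [IsProbabilityMeasure μ] (hP : ∀ᵐ γ ∂P, γ.IsAdmissible) :
    R.regret = ∫ ω, ∑ t ∈ Finset.range T, (lpValue ρ P
      - (R.auction t ω).value * (R.auction t ω).alloc (R.bid t ω)) ∂μ := by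
  simp_rw [Finset.sum_sub_distrib]
  change _ = ∫ ω, (_ - R.reward ω) ∂μ
  rw [integral_sub (integrable_const _) (R.integrable_reward hP)]
  simp [regret]

variable [IsProbabilityMeasure μ] [IsProbabilityMeasure P]

lemma integrable_width_value (hP : ∀ᵐ γ ∂P, γ.IsAdmissible) {t : ℕ} (ht : t < T) :
    Integrable (fun ω => valueWidth T (R.wins t ω) *
      ∑ b, R.actionDist t ω b * meanAlloc P b) μ := by
  refine Integrable.of_bound ?_ (∑ k ∈ Finset.range (t + 1), valueWidth T k) ?_
  · refine Measurable.aestronglyMeasurable ?_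
    refine ((R.measurable_valueWidth_wins ht.le).mono (R.ℱ.le _) le_rfl).mul
      (Finset.measurable_sum _ fun b _ => ?_)
    exact ((R.measurable_actionDist ht b).mono (R.ℱ.le _) le_rfl).mul_const _
  · filter_upwards [R.ae_actionDist_mem ht] with ω hω
    rw [Real.norm_eq_abs, abs_mul]
    refine (mul_le_of_le_one_right (abs_nonneg _) ?_).trans (R.abs_valueWidth_wins_le t ω)
    rw [abs_of_nonneg (Finset.sum_nonneg fun b _ => mul_nonneg (hω.1 b) (meanAlloc_mem hP b).1),
      ← hω.2]
    exact Finset.sum_le_sum fun b _ => mul_le_of_le_one_right (hω.1 b) (meanAlloc_mem hP b).2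

lemma integral_width (hP : ∀ᵐ γ ∂P, γ.IsAdmissible) {t : ℕ} (ht : t < T) :
    ∫ ω, R.width t ω ∂μ = 4 * functionRadius ℬ T t
      + ∫ ω, valueWidth T (R.wins t ω) * R.winInd t ω ∂μ := by
  have h := R.integral_mul_auction_winInd hP ht (R.measurable_valueWidth_wins ht.le)
    (Filter.Eventually.of_forall (R.abs_valueWidth_wins_le t))
    (measurable_const (a := (1 : ℝ))) (K' := 1) (by simp)
  simp only [one_mul, mul_one] at h
  rw [h]
  unfold width
  rw [integral_add (integrable_const _) (R.integrable_width_value hP ht)]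
  simp [meanAlloc]

/-- A loss `d` that is at most `1`, and whose conditional expectation given the past is controlled
by the widths of the confidence sets in all rounds but the first, accumulates to at most the total
width. -/
lemma integral_sum_le (hP : ∀ᵐ γ ∂P, γ.IsAdmissible)
    (hcor : ∀ b : ℬ, ∫ γ, γ.value * γ.alloc b ∂P = meanValue P * meanAlloc P b)
    (hB : 0 < ℬ.card) {d : Auction ℬ → ℬ → ℝ} (hd : ∀ b, Measurable fun γ => d γ b)
    {K : ℝ} (hdK : ∀ᵐ γ ∂P, ∀ b, |d γ b| ≤ K) (hd1 : ∀ᵐ γ ∂P, ∀ b, d γ b ≤ 1)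
    (hround : ∀ t, 0 < t → t < T → ∀ᵐ ω ∂μ,
      ∑ b, R.actionDist t ω b * ∫ γ, d γ b ∂P ≤ R.failBound t ω + R.width t ω) :
    ∫ ω, ∑ t ∈ Finset.range T, d (R.auction t ω) (R.bid t ω) ∂μ
      ≤ 1 + T * (2 / T + Real.exp 8 * √T / T)
        + 4 * ∑ t ∈ Finset.range T, √(Real.log (2 * (ℬ.card : ℝ) * T) / (2 * t))
        + ∑ n ∈ Finset.range T, valueWidth T n := by
  set F : ℝ := 2 / T + Real.exp 8 * √T / T
  have hF : 0 ≤ F := by positivity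
  have hwin : ∀ t < T, 0 ≤ ∫ ω, valueWidth T (R.wins t ω) * R.winInd t ω ∂μ := fun t _ =>
    integral_nonneg fun ω => mul_nonneg (valueWidth_nonneg _ _) (by
      rcases R.winInd_mem t ω with h | h <;> simp [h])
  have hone : ∀ t < T, ∫ ω, d (R.auction t ω) (R.bid t ω) ∂μ
      ≤ (if t = 0 then 1 else 0) + F + 4 * functionRadius ℬ T t
        + ∫ ω, valueWidth T (R.wins t ω) * R.winInd t ω ∂μ := by
    intro t ht
    have hr := functionRadius_nonneg ℬ T t
    by_cases h0 : t = 0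
    · have h1 : ∫ ω, d (R.auction t ω) (R.bid t ω) ∂μ ≤ ∫ _, (1 : ℝ) ∂μ := by
        refine integral_mono_ae (R.integrable_auction_bid ht hd hdK) (integrable_const _) ?_
        filter_upwards [R.ae_auction hd1 ht] with ω h
        exact h _
      simp only [integral_const, probReal_univ, smul_eq_mul, mul_one] at h1
      simp only [h0, if_true] at h1 hr ⊢
      have := hwin 0 (h0 ▸ ht)
      linarith
    · have h1 := R.integral_mul_auction_bid ht (measurable_const (a := (1 : ℝ))) (K := 1)
        (by simp) hd hdK
      simp only [one_mul] at h1
      simp only [h0, if_false, zero_add]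
      have hfi := R.integrable_failBound hP hcor ht.le
      have hwi : Integrable (R.width t) μ :=
        (integrable_const _).add (R.integrable_width_value hP ht)
      have h2 : ∫ ω, ∑ b, R.actionDist t ω b * ∫ γ, d γ b ∂P ∂μ
          ≤ ∫ ω, (R.failBound t ω + R.width t ω) ∂μ := by
        refine integral_mono_ae ?_ (hfi.add hwi) (hround t (Nat.pos_of_ne_zero h0) ht)
        refine integrable_finsetSum _ fun b _ => Integrable.mul_const ?_ _
        refine integrable_of_mem_Icc ((R.measurable_actionDist ht b).mono (R.ℱ.le _) le_rfl) ?_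
        filter_upwards [R.ae_actionDist_mem ht] with ω hω
        refine ⟨hω.1 b, ?_⟩
        rw [← hω.2]
        exact Finset.single_le_sum (fun c _ => hω.1 c) (Finset.mem_univ b)
      rw [integral_add hfi hwi, R.integral_width hP ht] at h2
      have h3 := R.integral_failBound_le hP hcor hB ht.le
      linarith
  have hwsum : ∑ t ∈ Finset.range T, ∫ ω, valueWidth T (R.wins t ω) * R.winInd t ω ∂μ
      ≤ ∑ n ∈ Finset.range T, valueWidth T n := by
    rw [← integral_finsetSum _ fun t ht =>
      R.integrable_valueWidth_mul_winInd (Finset.mem_range.1 ht)]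
    calc _ ≤ ∫ _, ∑ n ∈ Finset.range T, valueWidth T n ∂μ := by
          refine integral_mono (integrable_finsetSum _ fun t ht =>
            R.integrable_valueWidth_mul_winInd (Finset.mem_range.1 ht)) (integrable_const _)
            fun ω => ?_
          dsimp only
          rw [sum_valueWidth_mul_winInd]
          exact Finset.sum_le_sum_of_subset_of_nonneg
            (Finset.range_subset_range.2 (R.wins_le T ω)) fun n _ _ => valueWidth_nonneg _ _
      _ = _ := by simp
  rw [integral_finsetSum _ fun t ht => R.integrable_auction_bid (Finset.mem_range.1 ht) hd hdK]
  refine (Finset.sum_le_sum fun t ht => hone t (Finset.mem_range.1 ht)).trans ?_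
  rw [Finset.sum_add_distrib, Finset.sum_add_distrib, Finset.sum_add_distrib, Finset.sum_const,
    Finset.card_range, nsmul_eq_mul, ← Finset.mul_sum]
  refine add_le_add (add_le_add (add_le_add ?_ le_rfl) le_rfl) hwsum
  rw [Finset.sum_ite_eq']
  split_ifs <;> norm_num

lemma integral_loss (hP : ∀ᵐ γ ∂P, γ.IsAdmissible)
    (hcor : ∀ b : ℬ, ∫ γ, γ.value * γ.alloc b ∂P = meanValue P * meanAlloc P b) (c e : ℝ) (b : ℬ) :
    ∫ γ, (c + e * γ.paid b - γ.value * γ.alloc b) ∂P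
      = c + e * meanPaid P b - meanValue P * meanAlloc P b := by
  have hp : Integrable (fun γ : Auction ℬ => γ.paid b) P :=
    integrable_of_mem_Icc (Auction.measurable_paid b) (hP.mono fun _ h => h.paid_mem b)
  have hv : Integrable (fun γ : Auction ℬ => γ.value * γ.alloc b) P :=
    integrable_of_mem_Icc (Auction.measurable_value.mul (Auction.measurable_alloc b))
      (hP.mono fun _ h => ⟨mul_nonneg h.value_mem.1 (h.alloc_mem b).1,
        mul_le_one₀ h.value_mem.2 (h.alloc_mem b).1 (h.alloc_mem b).2⟩)
  have hcp : Integrable (fun γ : Auction ℬ => c + e * γ.paid b) P :=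
    (integrable_const c).add (hp.const_mul e)
  rw [integral_sub hcp hv, integral_add (integrable_const c) (hp.const_mul e),
    integral_const_mul, hcor]
  simp [meanPaid]

/-- All three criteria are bounded by the total width of the confidence sets. -/
lemma criteria_le (hP : ∀ᵐ γ ∂P, γ.IsAdmissible)
    (hcor : ∀ b : ℬ, ∫ γ, γ.value * γ.alloc b ∂P = meanValue P * meanAlloc P b)
    (hρ : 0 < ρ) (hB : 0 < ℬ.card) (hT : 0 < T) (hBT : 2 ≤ ℬ.card * T) :
    R.regret ≤ (20 + 2 * Real.exp 8) * √(T * Real.log (ℬ.card * T)) ∧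
    R.rosViolation ≤ (20 + 2 * Real.exp 8) * √(T * Real.log (ℬ.card * T)) ∧
    R.budgetViolation ≤ (20 + 2 * Real.exp 8) * √(T * Real.log (ℬ.card * T)) := by
  have htot := total_width_le hB hT hBT
  have hV := (lpValue_le_meanValue (ρ := ρ) hP).trans (meanValue_mem hP).2
  have hV0 : 0 ≤ lpValue ρ P := by
    refine Real.sSup_nonneg ?_
    rintro _ ⟨w, hw, rfl⟩
    exact gain_nonneg hP hw.mem_simplex
  have hround := fun t (h0 : 0 < t) (ht : t < T) => R.ae_round_bounds hP hρ h0 ht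
  refine ⟨?_, ?_, ?_⟩
  · rw [R.regret_eq hP]
    refine (R.integral_sum_le hP hcor hB
      (d := fun γ b => lpValue ρ P - γ.value * γ.alloc b) (K := 1) (fun b => by fun_prop) ?_ ?_
      fun t h0 ht => ?_).trans htot
    · filter_upwards [ae_loss_bounds hP] with γ h b
      rw [abs_le]
      constructor <;> linarith [(h b).2.1, (h b).2.2]
    · filter_upwards [ae_loss_bounds hP] with γ h b
      linarith [(h b).2.1]
    · filter_upwards [hround t h0 ht, R.ae_actionDist_mem ht] with ω h hw
      refine le_trans (le_of_eq ?_) h.1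
      have hi := fun b => integral_loss hP hcor (lpValue ρ P) 0 b
      simp only [zero_mul, add_zero] at hi
      simp_rw [hi, mul_sub, Finset.sum_sub_distrib, ← Finset.sum_mul]
      rw [hw.2, one_mul, gain_eq]
  · refine le_trans (le_of_eq ?_) ((R.integral_sum_le hP hcor hB
      (d := fun γ b => γ.paid b - γ.value * γ.alloc b) (K := 1) (fun b => by fun_prop) ?_ ?_
      fun t h0 ht => ?_).trans htot)
    · simp only [rosViolation, totalPaid, reward, Finset.sum_sub_distrib]
    · filter_upwards [ae_loss_bounds hP] with γ h b
      rw [abs_le]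
      constructor <;> linarith [(h b).2.1, (h b).2.2, (h b).1.1, (h b).1.2]
    · filter_upwards [ae_loss_bounds hP] with γ h b
      linarith [(h b).2.1, (h b).1.2]
    · filter_upwards [hround t h0 ht] with ω h
      refine le_trans (le_of_eq ?_) h.2.1
      have hi := fun b => integral_loss hP hcor 0 1 b
      simp only [zero_add, one_mul] at hi
      simp_rw [hi, mul_sub, Finset.sum_sub_distrib]
      rw [gain_eq, spend]
  · refine le_trans (le_of_eq ?_) ((R.integral_sum_le hP hcor hB
      (d := fun γ b => γ.paid b - ρ) (K := 1 + ρ) (fun b => by fun_prop) ?_ ?_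
      fun t h0 ht => ?_).trans htot)
    · simp only [budgetViolation, totalPaid, Finset.sum_sub_distrib, Finset.sum_const,
        Finset.card_range, nsmul_eq_mul, mul_comm ρ]
    · filter_upwards [ae_loss_bounds hP] with γ h b
      rw [abs_le]
      constructor <;> linarith [(h b).1.1, (h b).1.2]
    · filter_upwards [ae_loss_bounds hP] with γ h b
      linarith [(h b).1.2]
    · filter_upwards [hround t h0 ht, R.ae_actionDist_mem ht] with ω h hw
      refine le_trans (le_of_eq ?_) h.2.2
      have hi : ∀ b, ∫ γ, (γ.paid b - ρ) ∂P = meanPaid P b - ρ := fun b => by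
        rw [integral_sub (integrable_of_mem_Icc (Auction.measurable_paid b)
          (hP.mono fun _ h => h.paid_mem b)) (integrable_const _)]
        simp [meanPaid]
      simp_rw [hi, mul_sub, Finset.sum_sub_distrib, ← Finset.sum_mul]
      rw [hw.2, one_mul, spend]

/-- If `0` is the only bid then nothing is lost or paid. -/
lemma criteria_nonpos_of_eq_zero (hP : ∀ᵐ γ ∂P, γ.IsAdmissible)
    (hcor : ∀ b : ℬ, ∫ γ, γ.value * γ.alloc b ∂P = meanValue P * meanAlloc P b)
    (hρ : 0 < ρ) (h0 : (0 : ℝ≥0) ∈ ℬ) (hB : ∀ b ∈ ℬ, b = 0) :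
    R.regret ≤ 0 ∧ R.rosViolation ≤ 0 ∧ R.budgetViolation ≤ 0 := by
  set o : ℬ := ⟨0, h0⟩
  have hbid : ∀ b : ℬ, b = o := fun b => Subtype.ext (hB b b.2)
  have hpaid : ∀ᵐ ω ∂μ, ∀ t : Fin T, (R.auction t ω).paid (R.bid t ω) = 0 ∧
      0 ≤ (R.auction t ω).value * (R.auction t ω).alloc (R.bid t ω) := by
    refine ae_all_iff.2 fun t => ?_
    filter_upwards [R.ae_auction hP t.2] with ω h
    refine ⟨?_, mul_nonneg h.value_mem.1 (h.alloc_mem _).1⟩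
    have h1 := h.price_le_bid (R.bid t ω)
    have h2 := (h.price_mem (R.bid t ω)).1
    rw [hB _ (R.bid t ω).2, NNReal.coe_zero] at h1
    rw [Auction.paid, le_antisymm h1 h2, mul_zero]
  have htp : ∀ᵐ ω ∂μ, R.totalPaid ω = 0 ∧ 0 ≤ R.reward ω := by
    filter_upwards [hpaid] with ω h
    exact ⟨Finset.sum_eq_zero fun t ht => (h ⟨t, Finset.mem_range.1 ht⟩).1,
      Finset.sum_nonneg fun t ht => (h ⟨t, Finset.mem_range.1 ht⟩).2⟩
  refine ⟨?_, ?_, ?_⟩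
  · have hrew : ∫ ω, R.reward ω ∂μ = T * (meanValue P * meanAlloc P o) := by
      simp only [reward]
      rw [integral_finsetSum _ fun t ht => R.integrable_auction_bid (Finset.mem_range.1 ht)
        (d := fun γ b => γ.value * γ.alloc b) (K := 1)
        (fun b => Auction.measurable_value.mul (Auction.measurable_alloc b))
        ((ae_loss_bounds hP).mono fun γ h b => by
          rw [abs_of_nonneg (h b).2.1]; exact (h b).2.2)]
      simp_rw [hbid (R.bid _ _)]
      rw [Finset.sum_congr rfl fun t ht => (R.integral_auction
        (f := fun γ => γ.value * γ.alloc o) (by fun_prop) (Finset.mem_range.1 ht)).trans (hcor o)]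
      simp
    have hV : lpValue ρ P ≤ meanValue P * meanAlloc P o := by
      refine lpValue_le_of_feasible (mul_nonneg (meanValue_mem hP).1 (meanAlloc_mem hP o).1)
        fun w hw => ?_
      have h1 : gain w (meanValue P) (meanAlloc P)
          = ∑ b, w b * (meanValue P * meanAlloc P o) := by
        rw [gain_eq]
        exact Finset.sum_congr rfl fun b _ => by rw [hbid b]
      rw [h1, ← Finset.sum_mul, hw.mem_simplex.2, one_mul]
    have : (T : ℝ) * lpValue ρ P ≤ T * (meanValue P * meanAlloc P o) := by gcongr
    rw [regret, hrew]
    linarith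
  · refine integral_nonpos_of_ae ?_
    filter_upwards [htp] with ω h
    simp only [Pi.zero_apply]
    linarith [h.1, h.2]
  · refine integral_nonpos_of_ae ?_
    filter_upwards [htp] with ω h
    simp only [Pi.zero_apply]
    have : 0 ≤ ρ * T := by positivity
    linarith [h.1]

end UCBRoSRun

end OnlineBidding

theorem mainTheorem1 :
    ∃ C : ℝ, 0 < C ∧
      ∀ (ℬ : Finset ℝ≥0) (_ : (0 : ℝ≥0) ∈ ℬ) (ρ : ℝ) (_ : 0 < ρ) (T : ℕ) (_ : 0 < T)
        (P : Measure (OnlineBidding.Auction ℬ)) [IsProbabilityMeasure P]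
        (_ : ∀ᵐ γ ∂P, γ.IsAdmissible)
        (_ : ∀ b : ℬ, ∫ γ, γ.value * γ.alloc b ∂P =
          OnlineBidding.meanValue P * OnlineBidding.meanAlloc P b)
        (Ω : Type*) [MeasurableSpace Ω] (μ : Measure Ω) [IsProbabilityMeasure μ]
        (R : OnlineBidding.UCBRoSRun μ ℬ ρ T P),
        (0 < OnlineBidding.lpValue ρ P →
          R.regret ≤ C * max
            (√(OnlineBidding.meanValue P * T * Real.log (ℬ.card * T) / OnlineBidding.lpValue ρ P))
            (OnlineBidding.meanValue P ^ 2 * Real.log (ℬ.card * T)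
              / OnlineBidding.lpValue ρ P ^ 2)) ∧
        (0 < OnlineBidding.lpValue ρ P →
          R.rosViolation ≤ C *
            √(OnlineBidding.meanValue P * T * Real.log (ℬ.card * T)
              / OnlineBidding.lpValue ρ P)) ∧
        R.budgetViolation ≤ C * √(T * Real.log (ℬ.card * T)) := by
  refine ⟨20 + 2 * Real.exp 8, by positivity, ?_⟩
  intro ℬ h0 ρ hρ T hT P _ hP hcor Ω _ μ _ R
  have hBpos : 0 < ℬ.card := Finset.card_pos.2 ⟨0, h0⟩
  have hcrit : R.regret ≤ (20 + 2 * Real.exp 8) * √(T * Real.log (ℬ.card * T)) ∧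
      R.rosViolation ≤ (20 + 2 * Real.exp 8) * √(T * Real.log (ℬ.card * T)) ∧
      R.budgetViolation ≤ (20 + 2 * Real.exp 8) * √(T * Real.log (ℬ.card * T)) := by
    rcases Nat.lt_or_ge (ℬ.card * T) 2 with h | h
    · -- Here the logarithm vanishes, so the bounds have to hold without any slack.
      have hcard : ℬ.card = 1 := by nlinarith
      obtain ⟨h1, h2, h3⟩ := R.criteria_nonpos_of_eq_zero hP hcor hρ h0
        fun b hb => Finset.card_le_one.1 hcard.le b hb 0 h0
      have hC : 0 ≤ (20 + 2 * Real.exp 8) * √(T * Real.log (ℬ.card * T)) := by positivity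
      exact ⟨h1.trans hC, h2.trans hC, h3.trans hC⟩
    · exact R.criteria_le hP hcor hρ hBpos hT h
  have hmono : 0 < OnlineBidding.lpValue ρ P → √(T * Real.log (ℬ.card * T))
      ≤ √(OnlineBidding.meanValue P * T * Real.log (ℬ.card * T) / OnlineBidding.lpValue ρ P) := by
    intro hV
    have hlog : 0 ≤ Real.log ((ℬ.card : ℝ) * T) := by
      apply Real.log_nonneg
      exact_mod_cast Nat.mul_pos hBpos hT
    apply Real.sqrt_le_sqrt
    rw [le_div_iff₀ hV, mul_comm, mul_assoc (OnlineBidding.meanValue P)]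
    exact mul_le_mul_of_nonneg_right (OnlineBidding.UCBRoSRun.lpValue_le_meanValue hP)
      (by positivity)
  have hC : 0 ≤ 20 + 2 * Real.exp 8 := by positivity
  refine ⟨fun hV => hcrit.1.trans ?_, fun hV => hcrit.2.1.trans ?_, hcrit.2.2⟩
  · exact mul_le_mul_of_nonneg_left ((hmono hV).trans (le_max_left _ _)) hC
  · exact mul_le_mul_of_nonneg_left (hmono hV) hC
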